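/- \textbf{Setting.} A \emph{generalized link} $L=L_1\cup\dots\cup L_N\subset\mathbb R^3$ consists of finitely many rectifiable curves $\gamma_i$ of length $\ell_i>0$, parametrized by arclength $s\in[0,\ell_i]$ (so that the length of every subarc is the length of its parameter interval). Each $L_i$ is either closed ($\gamma_i$ is defined on the circle $\mathbb R/\ell_i\mathbb Z$) or an arc. Points on different components are distinct; a component may intersect itself. In addition: (i) each endpoint $x$ of an arc lies on a given affine subspace $M_x\subset\mathbb R^3$ of dimension $0$, $1$ or $2$; (ii) for each $i$ there are finitely many obstacles $\{g_{ij}<0\}$, where $g_{ij}:\mathbb R^3\to\mathbb R$ is $C^1$ with $0$ as a regular value, and $g_{ij}\ge 0$ on $L_i$. A \emph{smooth vector field} $\xi$ along $L$ assigns to each component a $C^\infty$ function $\xi_i$ of arclength with values in $\mathbb R^3$ (up to the endpoints on an arc, $\ell_i$-periodic on a closed component). It is \emph{compatible} if at each endpoint $x$ the vector $\xi_x$ is tangent to $M_x$. For $L_t=L+t\xi$ put $$\delta_\xi \mathrm{Len}=\frac{d}{dt}\Big|_{t=0}\mathrm{Len}(L_t),\qquad \delta^+_\xi \mathrm{Thi}=\frac{d}{dt}\Big|_{t=0^+}\mathrm{Thi}(L_t),\qquad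 \delta^+_\xi O=\frac{d}{dt}\Big|_{t=0^+}O(L_t),$$ where $\mathrm{Len}$ is total length, $\mathrm{Thi}$ is the minimum distance between points on different components, and $O=\min_{i,j}\min_{L_i}g_{ij}$. A term $\mathrm{Thi}$ or $O$ that is a minimum over the empty family (at most one component, or no obstacles) imposes no constraint; its derivative is read as $0$. The generalized link $L$ is \emph{strongly critical} (for minimizing length when constrained by $\mathrm{Thi}$) if there is $\varepsilon>0$ such that every compatible smooth $\xi$ with $\delta_\xi\mathrm{Len}=-1$ satisfies $$\min\big(\delta^+_\xi \mathrm{Thi},\ \delta^+_\xi O\big)\le-\varepsilon .$$ The \emph{total curvature} of a curve is the supremum, over all inscribed polygons with nonzero edges (closed polygons for closed components, open polygons for arcs), of the sum of the exterior turning angles. \textbf{Proposition.} Every strongly critical generalized link $L$ has finite total curvature and is $C^1$: the arclength parametrization of every component is continuously differentiable (on the whole circle for a closed component, and up to the endpoints for an arc). -/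

import Mathlib

open Set
open scoped ENNReal ContDiff

/-- Euclidean three-space. -/
abbrev E3 : Type := EuclideanSpace ℝ (Fin 3)

/-- The parameter domain of a component of length `ℓ`: for a closed component the whole line, on
which everything is `ℓ`-periodic, and for an arc the interval `[0, ℓ]`. -/
def paramDomain (closed : Prop) (ℓ : ℝ) : Set ℝ := {s | ¬ closed → s ∈ Icc 0 ℓ}

/-- A (rectifiable) generalized link with components `0, …, N - 1`, each of them a circle or an
arc, parametrized by arclength. Components may intersect themselves but not each other. -/
structure GeneralizedLink (N : ℕ) where
  /-- whether the component is a circle (otherwise it is an arc) -/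
  closed : Fin N → Prop
  /-- the length of the component -/
  len : Fin N → ℝ
  len_pos : ∀ i, 0 < len i
  /-- the arclength parametrization; for an arc only its values on `[0, len i]` matter -/
  γ : Fin N → ℝ → E3
  unitSpeed : ∀ i, HasUnitSpeedOn (γ i) (paramDomain (closed i) (len i))
  periodic : ∀ i, closed i → Function.Periodic (γ i) (len i)
  disjoint : ∀ i j, i ≠ j → ∀ s ∈ Icc 0 (len i), ∀ t ∈ Icc 0 (len j), γ i s ≠ γ j t
  /-- the affine subspace on which the initial endpoint of an arc is constrained to stay -/
  startSpace : Fin N → AffineSubspace ℝ E3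
  /-- the affine subspace on which the final endpoint of an arc is constrained to stay -/
  endSpace : Fin N → AffineSubspace ℝ E3
  start_mem : ∀ i, ¬ closed i → γ i 0 ∈ startSpace i
  end_mem : ∀ i, ¬ closed i → γ i (len i) ∈ endSpace i
  start_dim : ∀ i, ¬ closed i → Module.finrank ℝ (startSpace i).direction ≤ 2
  end_dim : ∀ i, ¬ closed i → Module.finrank ℝ (endSpace i).direction ≤ 2
  /-- the number of obstacles of the component -/
  numObst : Fin N → ℕ
  /-- the obstacles `{p | g i j p < 0}` of the component `i` -/
  g : (i : Fin N) → Fin (numObst i) → E3 → ℝ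
  g_contDiff : ∀ i j, ContDiff ℝ 1 (g i j)
  g_regular : ∀ i j p, g i j p = 0 → fderiv ℝ (g i j) p ≠ 0
  g_nonneg : ∀ i j, ∀ s ∈ Icc 0 (len i), 0 ≤ g i j (γ i s)

namespace GeneralizedLink

variable {N : ℕ} (L : GeneralizedLink N)

/-- The parameter domain of the `i`-th component. -/
def dom (i : Fin N) : Set ℝ := paramDomain (L.closed i) (L.len i)

/-! The next three functions are evaluated on a configuration `f` of the curve, that is, on any
family of maps with the same parameter domains as `L`. -/

/-- Total length (supremal length of inscribed polygons). -/
noncomputable def length (f : Fin N → ℝ → E3) : ℝ :=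
  ∑ i, (eVariationOn (f i) (Icc 0 (L.len i))).toReal

/-- Link-thickness: the minimal distance between points on different components (with the constant
value `0` if there is at most one component, where there is no such constraint). -/
noncomputable def thickness (f : Fin N → ℝ → E3) : ℝ :=
  sInf {d | ∃ i j, i ≠ j ∧ ∃ s ∈ Icc 0 (L.len i), ∃ t ∈ Icc 0 (L.len j),
    d = dist (f i s) (f j t)}

/-- The minimal value of an obstacle function on its component (with the constant value `0` if
there are no obstacles). -/
noncomputable def obstacleMin (f : Fin N → ℝ → E3) : ℝ :=
  sInf {d | ∃ i, ∃ j : Fin (L.numObst i), ∃ s ∈ Icc 0 (L.len i), d = L.g i j (f i s)}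

/-- Smooth vector fields along `L` (smooth functions of arclength). -/
def IsSmoothField (ξ : Fin N → ℝ → E3) : Prop :=
  ∀ i, ContDiffOn ℝ ∞ (ξ i) (L.dom i) ∧ (L.closed i → Function.Periodic (ξ i) (L.len i))

/-- Compatibility with the endpoint constraints. -/
def IsCompatible (ξ : Fin N → ℝ → E3) : Prop :=
  ∀ i, ¬ L.closed i →
    ξ i 0 ∈ (L.startSpace i).direction ∧ ξ i (L.len i) ∈ (L.endSpace i).direction

/-- The variation `L + t ξ`. -/
noncomputable def vary (ξ : Fin N → ℝ → E3) (t : ℝ) : Fin N → ℝ → E3 :=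
  fun i s => L.γ i s + t • ξ i s

/-- The first variation of length. -/
noncomputable def deltaLength (ξ : Fin N → ℝ → E3) : ℝ :=
  deriv (fun t => L.length (L.vary ξ t)) 0

/-- The one-sided first variation of link-thickness. If there is at most one component it is `0`;
such a value never makes the minimum in `StronglyCritical` negative. -/
noncomputable def deltaThickness (ξ : Fin N → ℝ → E3) : ℝ :=
  derivWithin (fun t => L.thickness (L.vary ξ t)) (Ici 0) 0

/-- The one-sided first variation of the minimum of the obstacle functions. If there are no
obstacles it is `0`; such a value never makes the minimum in `StronglyCritical` negative. -/
noncomputable def deltaObstacle (ξ : Fin N → ℝ → E3) : ℝ :=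
  derivWithin (fun t => L.obstacleMin (L.vary ξ t)) (Ici 0) 0

/-- Strong criticality for minimizing length when constrained by link-thickness. -/
def StronglyCritical : Prop :=
  ∃ ε > 0, ∀ ξ : Fin N → ℝ → E3, L.IsSmoothField ξ → L.IsCompatible ξ →
    L.deltaLength ξ = -1 → min (L.deltaThickness ξ) (L.deltaObstacle ξ) ≤ -ε

/-- The parameters `t 0 < t 1 < …` give an inscribed polygon with `k` turning angles and with
nonzero edges: for an arc an open polygon with vertices `t 0, …, t (k + 1)` in `[0, len i]`, for a
circle a closed polygon with the `k` vertices `t 0, …, t (k - 1)`, continued periodically. -/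
def IsInscribedPolygon (i : Fin N) (k : ℕ) (t : ℕ → ℝ) : Prop :=
  (∀ m ≤ k, t m < t (m + 1) ∧ L.γ i (t m) ≠ L.γ i (t (m + 1))) ∧
  (L.closed i → ∀ m, t (m + k) = t m + L.len i) ∧
  (¬ L.closed i → ∀ m ≤ k + 1, t m ∈ Icc 0 (L.len i))

/-- The total curvature of a component: the supremum of the sums of the turning angles of all
inscribed polygons. -/
noncomputable def totalCurvature (i : Fin N) : ℝ≥0∞ :=
  ⨆ (k : ℕ) (t : ℕ → ℝ) (_ : L.IsInscribedPolygon i k t),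
    ENNReal.ofReal (∑ m ∈ Finset.range k,
      InnerProductGeometry.angle (L.γ i (t (m + 1)) - L.γ i (t m))
        (L.γ i (t (m + 2)) - L.γ i (t (m + 1))))

/-- Finite total curvature. -/
def IsFTC : Prop := ∑ i, L.totalCurvature i < ⊤

/-- The arclength parametrization is `C¹` on every component (for an arc, up to the endpoints;
for a circle, as a periodic function on the line). -/
def IsC1 : Prop := ∀ i, ContDiffOn ℝ 1 (L.γ i) (L.dom i)

end GeneralizedLink

/-! Strong criticality amounts to a first variation inequality: a field that lowers thickness and
obstacle values at rate at most `c` shortens the link at rate at most `c / ε`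
(`StronglyCritical.exists_forall_neg_le`). For a field `φ` compactly supported inside one component,
so that endpoint constraints are not felt, the shortening rate is `-∫ ⟪γ', φ'⟫`, the pairing of `φ`
with the distributional derivative of the tangent. Two choices of `φ` give the result.

If `‖φ‖ ≤ 1`, the constraints decrease at a bounded rate, so `γ''` is a measure of finite mass
(`StronglyCritical.exists_bound`). By duality `γ'` has bounded variation on a set of full measure
(`eVariationOn_regularPoints_le`), and this variation controls the turning of inscribed polygons
(`sum_angle_le_of_eVariationOn_deriv_le`).

A tangent of bounded variation has one-sided limits, so only a jump from `p` to `q` at some `x`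
could spoil `C¹`. Pushing the curve near `x` along `q - p` shortens it at rate about `‖q - p‖²`,
however small the support. Yet no constraint suffers to first order: a distance or obstacle function
that is minimal at `x` has left derivative `≤ 0` and right derivative `≥ 0` along the curve, so its
derivative along `q - p` is nonnegative. Compactness makes this uniform near `x` up to an error `η`
(`StronglyCritical.exists_cutoff_bound`), whence `‖q - p‖² ≤ η` for every `η > 0`
(`contDiffOn_one_of_boundedVariationOn_deriv`). -/

open MeasureTheory Filter Topology intervalIntegral

/-! ### Lipschitz curves: length as the integral of speed, and its first variation. -/

section LipschitzCurves

variable {E : Type*} [NormedAddCommGroup E] [InnerProductSpace ℝ E] {f : ℝ → E} {K : NNReal} {a b : ℝ}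

theorem LipschitzOnWith.norm_deriv_le_of_mem_Ioo (hf : LipschitzOnWith K f (Icc a b)) {x : ℝ}
    (hx : x ∈ Ioo a b) : ‖deriv f x‖ ≤ K :=
  norm_deriv_le_of_lipschitzOn (Icc_mem_nhds hx.1 hx.2) hf

theorem ae_mem_Ioo_of_mem_uIoc (hab : a ≤ b) : ∀ᵐ x : ℝ, x ∈ uIoc a b → x ∈ Ioo a b := by
  have : ∀ᵐ x : ℝ, x ≠ b := by simp [ae_iff, measure_singleton]
  filter_upwards [this] with x hx h
  rw [uIoc_of_le hab] at h
  exact ⟨h.1, lt_of_le_of_ne h.2 hx⟩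

variable [FiniteDimensional ℝ E]

theorem LipschitzOnWith.intervalIntegrable_deriv' (hab : a ≤ b)
    (hf : LipschitzOnWith K f (Icc a b)) : IntervalIntegrable (deriv f) volume a b := by
  refine (intervalIntegrable_const (c := (K : ℝ))).mono_fun
    (aestronglyMeasurable_deriv f _) ?_
  rw [EventuallyLE, ae_restrict_iff' measurableSet_uIoc]
  filter_upwards [ae_mem_Ioo_of_mem_uIoc hab] with x hx h
  simpa using hf.norm_deriv_le_of_mem_Ioo (hx h)

theorem LipschitzOnWith.ae_differentiableAt_Ioo (hf : LipschitzOnWith K f (Icc a b)) :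
    ∀ᵐ x : ℝ, x ∈ Ioo a b → DifferentiableAt ℝ f x := by
  filter_upwards [hf.ae_differentiableWithinAt_of_mem_real] with x hx h
  exact (hx (Ioo_subset_Icc_self h)).differentiableAt (Icc_mem_nhds h.1 h.2)

/-- Pairing with each fixed vector reduces this to the scalar fundamental theorem for absolutely
continuous functions. -/
theorem LipschitzOnWith.integral_deriv_eq_sub' (hab : a ≤ b)
    (hf : LipschitzOnWith K f (Icc a b)) : ∫ s in a..b, deriv f s = f b - f a := by
  refine ext_inner_left ℝ fun e => ?_
  have hint := hf.intervalIntegrable_deriv' hab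
  have h1 : inner ℝ e (∫ s in a..b, deriv f s) = ∫ s in a..b, inner ℝ e (deriv f s) := by
    have := (innerSL ℝ e).intervalIntegral_comp_comm hint
    simpa using this.symm
  have hlip : LipschitzOnWith (‖innerSL ℝ e‖₊ * K) (fun s => inner ℝ e (f s)) (uIcc a b) := by
    rw [uIcc_of_le hab]
    exact ((innerSL ℝ e).lipschitz).comp_lipschitzOnWith hf
  have h2 := hlip.absolutelyContinuousOnInterval.integral_deriv_eq_sub
  rw [h1, inner_sub_right, ← h2]
  refine integral_congr_ae ?_
  filter_upwards [ae_mem_Ioo_of_mem_uIoc hab, hf.ae_differentiableAt_Ioo] with x hx hd h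
  have := ((innerSL ℝ e).hasFDerivAt.comp_hasDerivAt x (hd (hx h)).hasDerivAt).deriv
  simpa [Function.comp_def] using this.symm

/-- Increments of `f` are bounded by those of the primitive of its speed, which gives `≤`.
Conversely, the variation function `V` is monotone with `V' ≥ ‖f'‖` almost everywhere, and a
monotone function increases by at least the integral of its derivative. -/
theorem LipschitzOnWith.eVariationOn_toReal_eq_integral (hab : a ≤ b)
    (hf : LipschitzOnWith K f (Icc a b)) :
    (eVariationOn f (Icc a b)).toReal = ∫ s in a..b, ‖deriv f s‖ := by
  have hsub : ∀ {x y}, x ∈ Icc a b → y ∈ Icc a b → Icc x y ⊆ Icc a b :=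
    fun hx hy => Icc_subset_Icc hx.1 hy.2
  have hint := (hf.intervalIntegrable_deriv' hab).norm
  have hlb : LocallyBoundedVariationOn f (Icc a b) := hf.locallyBoundedVariationOn
  have hfin : ∀ x ∈ Icc a b, eVariationOn f (Icc a x) ≠ ⊤ := by
    intro x hx
    have := hlb a x ⟨le_rfl, hab⟩ hx
    rwa [inter_eq_right.2 (hsub ⟨le_rfl, hab⟩ hx)] at this
  have hadd : ∀ x y, a ≤ x → x ≤ y →
      eVariationOn f (Icc a y) = eVariationOn f (Icc a x) + eVariationOn f (Icc x y) := by
    intro x y hax hxy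
    have := eVariationOn.Icc_add_Icc f (s := univ) hax hxy (mem_univ x)
    simpa using this.symm
  apply le_antisymm
  · -- the integral of the speed dominates
    set W : ℝ → ℝ := fun x => ∫ s in a..x, ‖deriv f s‖ with hW
    have hinta : ∀ x ∈ Icc a b, ∀ y ∈ Icc a b,
        IntervalIntegrable (fun s => ‖deriv f s‖) volume x y := fun x hx y hy =>
      hint.mono_set (by
        rw [uIcc_of_le hab]; exact uIcc_subset_Icc hx hy)
    have haa : a ∈ Icc a b := ⟨le_rfl, hab⟩
    have hWsub : ∀ x ∈ Icc a b, ∀ y ∈ Icc a b, W y - W x = ∫ s in x..y, ‖deriv f s‖ := by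
      intro x hx y hy
      exact integral_interval_sub_left (hinta _ haa _ hy) (hinta _ haa _ hx)
    have hWmono : MonotoneOn W (Icc a b) := by
      intro x hx y hy hxy
      have := hWsub x hx y hy
      have h0 : 0 ≤ ∫ s in x..y, ‖deriv f s‖ :=
        integral_nonneg hxy fun _ _ => norm_nonneg _
      linarith
    have key : ∀ x ∈ Icc a b, ∀ y ∈ Icc a b, x ≤ y → dist (f y) (f x) ≤ dist (W y) (W x) := by
      intro x hx y hy hxy
      rw [dist_eq_norm, dist_eq_norm, hWsub x hx y hy,
        ← (hf.mono (hsub hx hy)).integral_deriv_eq_sub' hxy]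
      exact (intervalIntegral.norm_integral_le_integral_norm hxy).trans (le_abs_self _)
    have : eVariationOn f (Icc a b) ≤ ENNReal.ofReal (W b - W a) := by
      refine iSup_le fun p => ?_
      calc _ ≤ ∑ i ∈ Finset.range p.1, edist (W (p.2.1 (i + 1))) (W (p.2.1 i)) := by
            refine Finset.sum_le_sum fun i _ => ?_
            rw [edist_dist, edist_dist]
            exact ENNReal.ofReal_le_ofReal
              (key _ (p.2.2.2 _) _ (p.2.2.2 _) (p.2.2.1 (Nat.le_succ i)))
        _ ≤ eVariationOn W (Icc a b) := eVariationOn.sum_le p.2.2.1 p.2.2.2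
        _ ≤ eVariationOn W (Icc a b ∩ Icc a b) := by rw [inter_self]
        _ ≤ _ := (hWmono.eVariationOn_eq haa ⟨hab, le_rfl⟩).le
    have h0 : W a = 0 := by simp [hW]
    have h1 : 0 ≤ W b := integral_nonneg hab fun _ _ => norm_nonneg _
    rw [h0, sub_zero] at this
    exact ENNReal.toReal_le_of_le_ofReal h1 this
  · set V : ℝ → ℝ := fun x => (eVariationOn f (Icc a x)).toReal with hV
    have hVsub : ∀ x ∈ Icc a b, ∀ y ∈ Icc a b, x ≤ y → ‖f y - f x‖ ≤ V y - V x := by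
      intro x hx y hy hxy
      have h1 := hadd x y hx.1 hxy
      have h2 : eVariationOn f (Icc x y) ≠ ⊤ := by
        have := hfin y hy
        rw [h1] at this
        exact (ENNReal.add_ne_top.1 this).2
      have h3 : V y = V x + (eVariationOn f (Icc x y)).toReal := by
        simp only [hV]
        rw [h1, ENNReal.toReal_add (hfin x hx) h2]
      rw [h3, add_sub_cancel_left, ← dist_eq_norm]
      have := eVariationOn.edist_le f (s := Icc x y) (x := y) (y := x) ⟨hxy, le_rfl⟩ ⟨le_rfl, hxy⟩
      rw [edist_dist] at this
      exact (ENNReal.ofReal_le_iff_le_toReal h2).1 this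
    have hmono : MonotoneOn V (Icc a b) := fun x hx y hy hxy => by
      have := (norm_nonneg _).trans (hVsub x hx y hy hxy); linarith
    have hmono' : MonotoneOn V (uIcc a b) := by rwa [uIcc_of_le hab]
    have hVa : V a = 0 := by simp [hV, eVariationOn.subsingleton]
    have hVb : (eVariationOn f (Icc a b)).toReal = V b := rfl
    have h1 := hmono'.intervalIntegral_deriv_mem_uIcc
    have hab' : V a ≤ V b := hmono ⟨le_rfl, hab⟩ ⟨hab, le_rfl⟩ hab
    rw [hVa, sub_zero, uIcc_of_le (hVa ▸ hab')] at h1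
    rw [hVb]
    refine le_trans ?_ h1.2
    refine integral_mono_ae_restrict hab hint hmono'.intervalIntegrable_deriv ?_
    have hb : ∀ᵐ x : ℝ, x ≠ a ∧ x ≠ b := by
      have h1 : ∀ᵐ x : ℝ, x ≠ a := by simp [ae_iff, measure_singleton]
      have h2 : ∀ᵐ x : ℝ, x ≠ b := by simp [ae_iff, measure_singleton]
      filter_upwards [h1, h2] with x h h' using ⟨h, h'⟩
    rw [EventuallyLE, ae_restrict_iff' measurableSet_Icc]
    filter_upwards [hb, hf.ae_differentiableAt_Ioo, hmono.ae_differentiableWithinAt_of_mem]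
      with x hx hd hVd hxm
    have hxo : x ∈ Ioo a b := ⟨lt_of_le_of_ne hxm.1 hx.1.symm, lt_of_le_of_ne hxm.2 hx.2⟩
    have hVd' := ((hVd hxm).differentiableAt (Icc_mem_nhds hxo.1 hxo.2)).hasDerivAt
    have t1 := ((hasDerivAt_iff_tendsto_slope.1 (hd hxo).hasDerivAt).mono_left
      (nhdsWithin_mono x (fun y (hy : y ∈ Ioi x) => (ne_of_gt hy : y ≠ x)))).norm
    have t2 := (hasDerivAt_iff_tendsto_slope.1 hVd').mono_left
      (nhdsWithin_mono x (fun y (hy : y ∈ Ioi x) => (ne_of_gt hy : y ≠ x)))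
    refine le_of_tendsto_of_tendsto t1 t2 ?_
    filter_upwards [self_mem_nhdsWithin, nhdsWithin_le_nhds (Iio_mem_nhds hxo.2)] with y hy hyb
    have hxy : x < y := hy
    rw [slope_def_module, slope_def_module, norm_smul, smul_eq_mul, norm_inv, Real.norm_eq_abs,
      abs_of_pos (sub_pos.2 hxy)]
    exact mul_le_mul_of_nonneg_left (hVsub x hxm y ⟨hxm.1.trans hxy.le, hyb.le⟩ hxy.le)
      (inv_nonneg.2 (sub_pos.2 hxy).le)

/-- Along a curve whose subarcs have length at most (and in total equal to) that of their
parameter intervals, the speed is almost everywhere one. -/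
theorem ae_norm_deriv_eq_one (hab : a ≤ b) (hf : LipschitzOnWith 1 f (Icc a b))
    (hlen : (eVariationOn f (Icc a b)).toReal = b - a) :
    ∀ᵐ x : ℝ, x ∈ Ioo a b → ‖deriv f x‖ = 1 := by
  rw [hf.eVariationOn_toReal_eq_integral hab] at hlen
  have hint := (hf.intervalIntegrable_deriv' hab).norm
  have h0 : ∫ s in a..b, (1 - ‖deriv f s‖) = 0 := by
    rw [integral_sub intervalIntegrable_const hint, hlen]; simp
  have hnn : 0 ≤ᵐ[volume.restrict (Ioc a b)] fun s => 1 - ‖deriv f s‖ := by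
    rw [EventuallyLE, ae_restrict_iff' measurableSet_Ioc]
    filter_upwards [ae_mem_Ioo_of_mem_uIoc hab] with x hx h
    rw [uIoc_of_le hab] at hx
    have := hf.norm_deriv_le_of_mem_Ioo (hx h)
    simpa using this
  rw [integral_eq_zero_iff_of_le_of_nonneg_ae hab hnn (intervalIntegrable_const.sub hint),
    EventuallyEq, ae_restrict_iff' measurableSet_Ioc] at h0
  filter_upwards [h0] with x hx h
  have := hx ⟨h.1, h.2.le⟩
  simp only [Pi.zero_apply] at this
  linarith

/-- First variation of the length of a unit speed curve. -/
theorem hasDerivAt_length_add_smul (hab : a ≤ b) (hf : LipschitzOnWith 1 f (Icc a b))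
    (hlen : (eVariationOn f (Icc a b)).toReal = b - a) {φ : ℝ → E} (hφ : ContDiff ℝ ∞ φ) :
    HasDerivAt (fun t : ℝ => (eVariationOn (fun s => f s + t • φ s) (Icc a b)).toReal)
      (∫ s in a..b, inner ℝ (deriv f s) (deriv φ s)) 0 := by
  obtain ⟨M, hM⟩ := (hφ.of_le (m := 1) (by simp)).contDiffOn.exists_lipschitzOnWith (by decide)
    (convex_Icc a b) isCompact_Icc
  have hdiff : ∀ s, DifferentiableAt ℝ φ s := fun s => hφ.differentiable (by simp) s
  have hlip : ∀ t : ℝ, LipschitzOnWith (1 + ‖t‖₊ * M) (fun s => f s + t • φ s) (Icc a b) := by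
    intro t
    exact hf.add ((lipschitzWith_smul t).comp_lipschitzOnWith hM)
  have heq : ∀ t : ℝ, (eVariationOn (fun s => f s + t • φ s) (Icc a b)).toReal
      = ∫ s in a..b, ‖deriv f s + t • deriv φ s‖ := by
    intro t
    rw [(hlip t).eVariationOn_toReal_eq_integral hab]
    refine integral_congr_ae ?_
    filter_upwards [ae_mem_Ioo_of_mem_uIoc hab, hf.ae_differentiableAt_Ioo] with x hx hd h
    congr 1
    exact ((hd (hx h)).hasDerivAt.add ((hdiff x).hasDerivAt.const_smul t)).deriv
  simp_rw [heq]
  have hmeas : ∀ t : ℝ, AEStronglyMeasurable (fun s => ‖deriv f s + t • deriv φ s‖)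
      (volume.restrict (uIoc a b)) := fun t =>
    ((aestronglyMeasurable_deriv f _).add ((aestronglyMeasurable_deriv φ _).const_smul t)).norm
  have hφi : IntervalIntegrable (deriv φ) volume a b :=
    (hφ.continuous_deriv (by simp)).intervalIntegrable _ _
  -- The integrand is Lipschitz in `t` with constant `‖φ'‖`, so differentiability in `t` is needed
  -- only at `t = 0`; there the norm is evaluated at a unit vector.
  refine (intervalIntegral.hasDerivAt_integral_of_dominated_loc_of_lip
    (F := fun t s => ‖deriv f s + t • deriv φ s‖) (bound := fun s => ‖deriv φ s‖)
    (s := univ) univ_mem ?_ ?_ ?_ ?_ ?_ ?_).2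
  · exact Eventually.of_forall hmeas
  · simpa using (hf.intervalIntegrable_deriv' hab).norm
  · exact (aestronglyMeasurable_deriv f _).inner (aestronglyMeasurable_deriv φ _)
  · refine Eventually.of_forall fun s _ => ?_
    refine LipschitzOnWith.of_dist_le_mul fun t _ u _ => ?_
    rw [Real.dist_eq, Real.coe_nnabs, abs_norm]
    refine (abs_norm_sub_norm_le _ _).trans ?_
    rw [add_sub_add_left_eq_sub, ← sub_smul, norm_smul, mul_comm, Real.dist_eq, Real.norm_eq_abs]
  · exact hφi.norm
  · filter_upwards [ae_mem_Ioo_of_mem_uIoc hab, ae_norm_deriv_eq_one hab hf hlen] with x hx h1 h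
    have hne : deriv f x + (0 : ℝ) • deriv φ x ≠ 0 := by
      have := h1 (hx h)
      intro h'
      rw [zero_smul, add_zero] at h'
      rw [h', norm_zero] at this
      exact zero_ne_one this
    have hd : HasDerivAt (fun t : ℝ => deriv f x + t • deriv φ x) (deriv φ x) 0 := by
      simpa using ((hasDerivAt_id (0 : ℝ)).smul_const (deriv φ x)).const_add (deriv f x)
    have := hd.norm_sq
    have h2 := this.sqrt (by positivity)
    simp only [Real.sqrt_sq (norm_nonneg _)] at h2
    have h3 : 2 * inner ℝ (deriv f x + (0 : ℝ) • deriv φ x) (deriv φ x) /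
        (2 * ‖deriv f x + (0 : ℝ) • deriv φ x‖) = inner ℝ (deriv f x) (deriv φ x) := by
      rw [zero_smul, add_zero, h1 (hx h)]
      ring
    rwa [h3] at h2

end LipschitzCurves

/-! ### Smoothed step fields, and variation by duality. -/

section SmoothSteps

/-- The primitive of a normed bump function: a smooth step from `0` to `1`. -/
noncomputable def smoothStep (φ : ContDiffBump (0 : ℝ)) (x : ℝ) : ℝ :=
  ∫ t in (-φ.rOut)..x, φ.normed volume t

variable (φ : ContDiffBump (0 : ℝ))

theorem hasDerivAt_smoothStep (x : ℝ) : HasDerivAt (smoothStep φ) (φ.normed volume x) x :=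
  integral_hasDerivAt_right (φ.continuous_normed.intervalIntegrable _ _)
    (φ.continuous_normed.stronglyMeasurableAtFilter _ _) φ.continuous_normed.continuousAt

theorem deriv_smoothStep : deriv (smoothStep φ) = φ.normed volume :=
  funext fun x => (hasDerivAt_smoothStep φ x).deriv

theorem contDiff_smoothStep : ContDiff ℝ ∞ (smoothStep φ) := by
  rw [contDiff_infty_iff_deriv, deriv_smoothStep]
  exact ⟨fun x => (hasDerivAt_smoothStep φ x).differentiableAt, φ.contDiff_normed⟩

theorem monotone_smoothStep : Monotone (smoothStep φ) :=
  monotone_of_deriv_nonneg (fun x => (hasDerivAt_smoothStep φ x).differentiableAt) fun x => by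
    rw [deriv_smoothStep]; exact φ.nonneg_normed x

theorem normed_eq_zero_of_le_abs {x : ℝ} (hx : φ.rOut ≤ |x|) : φ.normed volume x = 0 := by
  have : x ∉ Function.support (φ.normed volume) := by
    rw [φ.support_normed_eq]
    simpa using hx
  simpa using this

theorem smoothStep_eq_zero {x : ℝ} (hx : x ≤ -φ.rOut) : smoothStep φ x = 0 := by
  rw [smoothStep, integral_congr (g := fun _ => 0)]
  · simp
  · intro t ht
    rw [uIcc_of_ge hx] at ht
    exact normed_eq_zero_of_le_abs φ (by rw [abs_of_nonpos (by linarith [ht.2, φ.rOut_pos])]; linarith [ht.2])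

theorem smoothStep_eq_one {x : ℝ} (hx : φ.rOut ≤ x) : smoothStep φ x = 1 := by
  have h1 : smoothStep φ x = ∫ t, φ.normed volume t := by
    rw [smoothStep, integral_of_le (by linarith [φ.rOut_pos])]
    refine setIntegral_eq_integral_of_forall_compl_eq_zero fun t ht => ?_
    apply normed_eq_zero_of_le_abs
    by_contra! hlt
    rw [abs_lt] at hlt
    exact ht ⟨hlt.1, by linarith [hlt.2]⟩
  rw [h1, φ.integral_normed]

theorem smoothStep_nonneg (x : ℝ) : 0 ≤ smoothStep φ x := by
  rcases le_total x (-φ.rOut) with h | h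
  · exact (smoothStep_eq_zero φ h).ge
  · rw [← smoothStep_eq_zero φ le_rfl]; exact monotone_smoothStep φ h

theorem smoothStep_le_one (x : ℝ) : smoothStep φ x ≤ 1 := by
  rcases le_total φ.rOut x with h | h
  · exact (smoothStep_eq_one φ h).le
  · rw [← smoothStep_eq_one φ le_rfl]; exact monotone_smoothStep φ h

variable {E : Type*} [NormedAddCommGroup E] [InnerProductSpace ℝ E]

/-- The field that is (approximately) `v m` between `s m` and `s (m + 1)`. -/
noncomputable def stepField (k : ℕ) (s : ℕ → ℝ) (v : ℕ → E) (r : ℝ) : E :=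
  ∑ m ∈ Finset.range k, (smoothStep φ (r - s m) - smoothStep φ (r - s (m + 1))) • v m

variable {φ} {k : ℕ} {s : ℕ → ℝ} {v : ℕ → E}

theorem contDiff_stepField : ContDiff ℝ ∞ (stepField φ k s v) := by
  refine ContDiff.sum fun m _ => ContDiff.smul (ContDiff.sub ?_ ?_) contDiff_const
  · exact (contDiff_smoothStep φ).comp (contDiff_id.sub contDiff_const)
  · exact (contDiff_smoothStep φ).comp (contDiff_id.sub contDiff_const)

theorem hasDerivAt_stepField (r : ℝ) : HasDerivAt (stepField φ k s v)
    (∑ m ∈ Finset.range k,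
      (φ.normed volume (r - s m) - φ.normed volume (r - s (m + 1))) • v m) r := by
  refine HasDerivAt.fun_sum fun m _ => HasDerivAt.smul_const (HasDerivAt.sub ?_ ?_) _
  · exact (hasDerivAt_smoothStep φ _).comp_sub_const r (s m)
  · exact (hasDerivAt_smoothStep φ _).comp_sub_const r (s (m + 1))

theorem norm_stepField_le (hs : Monotone s) (hv : ∀ m, ‖v m‖ ≤ 1) (r : ℝ) :
    ‖stepField φ k s v r‖ ≤ 1 := by
  calc ‖stepField φ k s v r‖
      ≤ ∑ m ∈ Finset.range k, (smoothStep φ (r - s m) - smoothStep φ (r - s (m + 1))) := by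
        refine norm_sum_le_of_le _ fun m _ => ?_
        have h0 : 0 ≤ smoothStep φ (r - s m) - smoothStep φ (r - s (m + 1)) :=
          sub_nonneg.2 (monotone_smoothStep φ (by linarith [hs (Nat.le_succ m)]))
        rw [norm_smul, Real.norm_eq_abs, abs_of_nonneg h0]
        exact mul_le_of_le_one_right h0 (hv m)
    _ = smoothStep φ (r - s 0) - smoothStep φ (r - s k) :=
        Finset.sum_range_sub' (fun m => smoothStep φ (r - s m)) k
    _ ≤ 1 := by linarith [smoothStep_le_one φ (r - s 0), smoothStep_nonneg φ (r - s k)]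

theorem stepField_eq_zero (hs : Monotone s) {r : ℝ} (hr : r ∉ Icc (s 0 - φ.rOut) (s k + φ.rOut)) :
    stepField φ k s v r = 0 := by
  refine Finset.sum_eq_zero fun m hm => ?_
  have hm' : m + 1 ≤ k := Finset.mem_range.1 hm
  have h0 := hs (Nat.zero_le m)
  have h1 := hs (Nat.le_succ m)
  have h2 := hs hm'
  rcases lt_or_ge r (s 0 - φ.rOut) with h | h
  · rw [smoothStep_eq_zero φ (by linarith), smoothStep_eq_zero φ (by simp at h1; linarith)]; simp
  · have : s k + φ.rOut < r := by by_contra! h'; exact hr ⟨h, h'⟩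
    rw [smoothStep_eq_one φ (by simp at h1; linarith), smoothStep_eq_one φ (by linarith)]; simp

/-- A shrinking sequence of bump functions. -/
noncomputable def shrinkingBump (n : ℕ) : ContDiffBump (0 : ℝ) where
  rIn := 1 / ((n : ℝ) + 1)
  rOut := 2 / ((n : ℝ) + 1)
  rIn_pos := by positivity
  rIn_lt_rOut := by gcongr; norm_num

theorem tendsto_shrinkingBump_rOut :
    Tendsto (fun n => (shrinkingBump n).rOut) atTop (𝓝 0) := by
  have := (tendsto_one_div_add_atTop_nhds_zero_nat (𝕜 := ℝ)).const_mul 2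
  simpa [shrinkingBump, div_eq_mul_inv] using this

/-- `φ` vanishes outside of a compact subset of `(a, b)`. -/
def SupportedIn (φ : ℝ → E) (a b : ℝ) : Prop :=
  ∃ c d, a < c ∧ d < b ∧ ∀ r, r ∉ Icc c d → φ r = 0

theorem eventually_supportedIn_stepField {c d : ℝ} (hs : Monotone s) (h0 : c < s 0)
    (hk : s k < d) : ∀ᶠ n in atTop, SupportedIn (stepField (shrinkingBump n) k s v) c d := by
  have h1 := tendsto_shrinkingBump_rOut.eventually_lt_const (sub_pos.2 h0)
  have h2 := tendsto_shrinkingBump_rOut.eventually_lt_const (sub_pos.2 hk)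
  filter_upwards [h1, h2] with n h1 h2
  exact ⟨_, _, by linarith, by linarith, fun r hr => stepField_eq_zero hs hr⟩

variable [FiniteDimensional ℝ E] {T : ℝ → E} {a b : ℝ}

/-- The points of `(a, b)` at which `T` is the limit of its mollifications. -/
def regularPoints (T : ℝ → E) (a b : ℝ) : Set ℝ :=
  {x ∈ Ioo a b | Tendsto (fun n => ∫ r in a..b, (shrinkingBump n).normed volume (r - x) • T r)
    atTop (𝓝 (T x))}

/-- Almost every point is a Lebesgue point of `T` cut off to `(a, b)`. The bounded ratio of outer to
inner radius lets the mollifications converge there. -/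
theorem ae_mem_regularPoints (hab : a ≤ b) (hT : IntervalIntegrable T volume a b) :
    ∀ᵐ x : ℝ, x ∈ Ioo a b → x ∈ regularPoints T a b := by
  have hg : LocallyIntegrable ((Ioo a b).indicator T) volume := by
    rw [intervalIntegrable_iff_integrableOn_Ioo_of_le hab] at hT
    exact (hT.integrable_indicator measurableSet_Ioo).locallyIntegrable
  have := ContDiffBump.ae_convolution_tendsto_right_of_locallyIntegrable (μ := volume)
    (φ := shrinkingBump) (K := 2) tendsto_shrinkingBump_rOut
    (Eventually.of_forall fun n => by simp [shrinkingBump, div_eq_mul_inv]) hg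
  filter_upwards [this] with x hx hxm
  refine ⟨hxm, ?_⟩
  rw [indicator_of_mem hxm] at hx
  refine hx.congr fun n => ?_
  rw [convolution_eq_swap, integral_of_le hab, integral_Ioc_eq_integral_Ioo, ← MeasureTheory.integral_indicator measurableSet_Ioo]
  congr 1
  ext r
  rw [ContinuousLinearMap.lsmul_apply, ← ContDiffBump.normed_neg, neg_sub]
  by_cases hr : r ∈ Ioo a b <;> simp [hr]

/-- The derivative of a step field is a combination of bumps at the break points, so the pairing
sees only differences of mollified values of `T`. -/
theorem neg_integral_inner_deriv_stepField (hT : IntervalIntegrable T volume a b) :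
    -∫ r in a..b, inner ℝ (T r) (deriv (stepField φ k s v) r) =
      ∑ m ∈ Finset.range k, inner ℝ (v m)
        ((∫ r in a..b, φ.normed volume (r - s (m + 1)) • T r)
          - ∫ r in a..b, φ.normed volume (r - s m) • T r) := by
  have hint : ∀ x : ℝ, IntervalIntegrable (fun r => φ.normed volume (r - x) • T r) volume a b :=
    fun x => hT.continuousOn_smul
      (φ.continuous_normed.comp (continuous_id.sub continuous_const)).continuousOn
  have hint' : ∀ m, IntervalIntegrable (fun r => φ.normed volume (r - s (m + 1)) • T r
      - φ.normed volume (r - s m) • T r) volume a b := fun m => (hint _).sub (hint _)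
  have hin : ∀ m, IntervalIntegrable (fun r => inner ℝ (v m)
      (φ.normed volume (r - s (m + 1)) • T r - φ.normed volume (r - s m) • T r)) volume a b := by
    intro m
    rw [intervalIntegrable_iff] at *
    exact (innerSL ℝ (v m)).integrable_comp (intervalIntegrable_iff.1 (hint' m))
  have : ∀ m, inner ℝ (v m)
      ((∫ r in a..b, φ.normed volume (r - s (m + 1)) • T r)
          - ∫ r in a..b, φ.normed volume (r - s m) • T r) =
      ∫ r in a..b, inner ℝ (v m)
        (φ.normed volume (r - s (m + 1)) • T r - φ.normed volume (r - s m) • T r) := by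
    intro m
    rw [← integral_sub (hint _) (hint _)]
    exact ((innerSL ℝ (v m)).intervalIntegral_comp_comm (hint' m)).symm
  simp_rw [this]
  rw [← integral_finsetSum fun m _ => hin m, ← intervalIntegral.integral_neg]
  refine integral_congr fun r _ => ?_
  simp only [(hasDerivAt_stepField r).deriv, inner_sum, ← Finset.sum_neg_distrib]
  refine Finset.sum_congr rfl fun m _ => ?_
  rw [← sub_smul, inner_smul_right, inner_smul_right, real_inner_comm (T r)]
  ring

theorem tendsto_neg_integral_inner_deriv_stepField (hT : IntervalIntegrable T volume a b)
    (hs : ∀ m, s m ∈ regularPoints T a b) :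
    Tendsto (fun n => -∫ r in a..b, inner ℝ (T r) (deriv (stepField (shrinkingBump n) k s v) r))
      atTop (𝓝 (∑ m ∈ Finset.range k, inner ℝ (v m) (T (s (m + 1)) - T (s m)))) := by
  simp_rw [neg_integral_inner_deriv_stepField hT]
  exact tendsto_finsetSum _ fun m _ => tendsto_const_nhds.inner ((hs _).2.sub (hs _).2)

/-- If the distributional derivative of `T` is a measure of mass at most `C`, then `T` has
variation at most `C`. -/
theorem eVariationOn_regularPoints_le (hT : IntervalIntegrable T volume a b) {C : ℝ}
    (h : ∀ φ : ℝ → E, ContDiff ℝ ∞ φ → SupportedIn φ a b → (∀ r, ‖φ r‖ ≤ 1) →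
      -∫ r in a..b, inner ℝ (T r) (deriv φ r) ≤ C) :
    eVariationOn T (regularPoints T a b) ≤ ENNReal.ofReal C := by
  refine iSup_le fun p => ?_
  obtain ⟨k, s, hs, hm⟩ := p
  -- Unit vectors along the increments turn the pairing into the sum of their norms; a zero
  -- increment gets `v m = 0`, since `0⁻¹ = 0`.
  set v : ℕ → E := fun m => (‖T (s (m + 1)) - T (s m)‖⁻¹ : ℝ) • (T (s (m + 1)) - T (s m)) with hv
  have hv1 : ∀ m, ‖v m‖ ≤ 1 := by
    intro m
    rw [hv]
    simp only [norm_smul, norm_inv, norm_norm]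
    exact inv_mul_le_one
  have hle : ∑ m ∈ Finset.range k, inner ℝ (v m) (T (s (m + 1)) - T (s m)) ≤ C := by
    refine le_of_tendsto (tendsto_neg_integral_inner_deriv_stepField hT hm) ?_
    filter_upwards [eventually_supportedIn_stepField (v := v) hs (hm 0).1.1 (hm k).1.2] with n hn
    exact h _ contDiff_stepField hn fun r => norm_stepField_le hs hv1 r
  calc ∑ i ∈ Finset.range k, edist (T (s (i + 1))) (T (s i))
      = ENNReal.ofReal (∑ i ∈ Finset.range k, dist (T (s (i + 1))) (T (s i))) := by
        rw [ENNReal.ofReal_sum_of_nonneg fun _ _ => dist_nonneg]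
        simp_rw [edist_dist]
    _ ≤ ENNReal.ofReal C := by
        refine ENNReal.ofReal_le_ofReal (le_trans (le_of_eq ?_) hle)
        refine Finset.sum_congr rfl fun m _ => ?_
        rw [dist_eq_norm, hv, real_inner_smul_left, real_inner_self_eq_norm_sq]
        rcases eq_or_ne ‖T (s (m + 1)) - T (s m)‖ 0 with h0 | h0
        · simp [h0]
        · field_simp

/-- Testing against a smooth cutoff of a constant vector near a point. -/
theorem inner_sub_le_of_forall_cutoff (hT : IntervalIntegrable T volume a b) {c d η : ℝ} {w : E}
    (h : ∀ χ : ℝ → ℝ, ContDiff ℝ ∞ χ → SupportedIn χ c d → (∀ r, χ r ∈ Icc (0 : ℝ) 1) →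
      -∫ r in a..b, inner ℝ (T r) (deriv (fun r => χ r • w) r) ≤ η)
    {x y : ℝ} (hx : x ∈ regularPoints T a b) (hy : y ∈ regularPoints T a b) (hcx : c < x)
    (hxy : x ≤ y) (hyd : y < d) : inner ℝ w (T y - T x) ≤ η := by
  -- A single step: the test function approximates the indicator of `[x, y]`.
  set s : ℕ → ℝ := fun m => if m = 0 then x else y with hs
  have hmono : Monotone s := monotone_nat_of_le_succ fun m => by
    by_cases hm : m = 0 <;> simp [hs, hm, hxy]
  have hmem : ∀ m, s m ∈ regularPoints T a b := fun m => by
    by_cases hm : m = 0 <;> simp [hs, hm, hx, hy]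
  have key := tendsto_neg_integral_inner_deriv_stepField (k := 1) (v := fun _ => w) hT hmem
  simp only [Finset.range_one, Finset.sum_singleton] at key
  have e0 : s 0 = x := by simp [hs]
  have e1 : s (0 + 1) = y := by simp [hs]
  rw [e0, e1] at key
  refine le_of_tendsto key ?_
  filter_upwards [eventually_supportedIn_stepField (k := 1) (v := fun _ => (1 : ℝ)) hmono
    (by rwa [e0]) (show s 1 < d by simpa [hs] using hyd)] with n hn
  have hfun : ∀ r, stepField (shrinkingBump n) 1 s (fun _ => w) r
      = stepField (shrinkingBump n) 1 s (fun _ => (1 : ℝ)) r • w := by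
    intro r; simp [stepField]
  have := h (stepField (shrinkingBump n) 1 s (fun _ => (1 : ℝ))) contDiff_stepField hn fun r => by
    have h1 := norm_stepField_le (φ := shrinkingBump n) (k := 1) (v := fun _ => (1 : ℝ)) hmono
      (fun _ => by simp) r
    refine ⟨?_, (le_abs_self _).trans h1⟩
    simp only [stepField, Finset.range_one, Finset.sum_singleton, smul_eq_mul, mul_one]
    exact sub_nonneg.2 (monotone_smoothStep _ (by linarith [hmono (Nat.le_succ 0)]))
  rwa [← funext hfun] at this

end SmoothSteps

/-! ### Curves with tangent of bounded variation: turning angles and jumps. -/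

section BoundedVariationTangent

variable {E : Type*} [NormedAddCommGroup E] [InnerProductSpace ℝ E]

/-- If `V < 1` the angle `θ` is acute, and `sin θ` is the distance from `u` to the line through `x`,
hence at most `V`; Jordan's inequality `2θ/π ≤ sin θ` concludes. If `V ≥ 1` the bound exceeds `π`.
-/
theorem angle_le_pi_mul_of_norm_sub_le {x u : E} {V : ℝ} (hu : ‖u‖ = 1) (h : ‖x - u‖ ≤ V) :
    InnerProductGeometry.angle x u ≤ Real.pi * V := by
  have hpi := Real.pi_pos
  rcases le_or_gt 1 V with hV | hV
  · exact (InnerProductGeometry.angle_le_pi x u).trans (le_mul_of_one_le_right hpi.le hV)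
  have hV0 : 0 ≤ V := (norm_nonneg _).trans h
  set θ := InnerProductGeometry.angle x u with hθ
  have hcos : Real.cos θ * ‖x‖ = inner ℝ x u := by
    have := InnerProductGeometry.cos_angle_mul_norm_mul_norm x u
    rwa [hu, mul_one] at this
  have hsq : ‖x - u‖ ^ 2 = ‖x‖ ^ 2 - 2 * inner ℝ x u + 1 := by
    rw [norm_sub_sq_real, hu]; ring
  have hsq' : ‖x - u‖ ^ 2 ≤ V ^ 2 := pow_le_pow_left₀ (norm_nonneg _) h 2
  have hinner : 0 < inner ℝ x u := by nlinarith [sq_nonneg ‖x‖]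
  have hx : 0 < ‖x‖ := by
    rw [norm_pos_iff]; rintro rfl; simp at hinner
  have hcos0 : 0 ≤ Real.cos θ := by
    by_contra! hneg
    nlinarith
  have hθ0 : 0 ≤ θ := InnerProductGeometry.angle_nonneg x u
  have hθ1 : θ ≤ Real.pi / 2 := by
    by_contra! hgt
    have := Real.cos_neg_of_pi_div_two_lt_of_lt hgt
      (by linarith [InnerProductGeometry.angle_le_pi x u])
    linarith
  have hsin : Real.sin θ ≤ V := by
    have h1 : Real.sin θ ^ 2 ≤ V ^ 2 := by
      nlinarith [Real.sin_sq_add_cos_sq θ, sq_nonneg (‖x‖ - Real.cos θ)]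
    exact abs_le_of_sq_le_sq' h1 hV0 |>.2
  have := Real.mul_le_sin hθ0 hθ1
  have h2 : 2 / Real.pi * θ ≤ V := this.trans hsin
  rw [div_mul_eq_mul_div, div_le_iff₀ hpi] at h2
  nlinarith

theorem sum_eVariationOn_inter_Icc_le {F : Type*} [PseudoEMetricSpace F] (g : ℝ → F) (S : Set ℝ)
    {t : ℕ → ℝ} (ht : Monotone t) (n : ℕ) :
    ∑ m ∈ Finset.range n, eVariationOn g (S ∩ Icc (t m) (t (m + 1))) ≤
      eVariationOn g (S ∩ Icc (t 0) (t n)) := by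
  induction n with
  | zero => simp
  | succ n ih =>
    rw [Finset.sum_range_succ]
    refine (add_le_add_left ih _).trans ?_
    refine (eVariationOn.add_le_union g fun x hx y hy => hx.2.2.trans hy.2.1).trans ?_
    refine eVariationOn.mono g ?_
    rw [← inter_union_distrib_left,
      Icc_union_Icc_eq_Icc (ht (Nat.zero_le n)) (ht (Nat.le_succ n))]

variable {f : ℝ → E} {a b : ℝ} {S : Set ℝ}

theorem exists_mem_Ioo_of_ae (hS : ∀ᵐ x : ℝ, x ∈ Ioo a b → x ∈ S) {c d : ℝ} (hac : a ≤ c)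
    (hcd : c < d) (hdb : d ≤ b) : ∃ p ∈ S, p ∈ Ioo c d := by
  obtain ⟨p, hp, hpm⟩ := (Measure.dense_of_ae hS).exists_between hcd
  exact ⟨p, hp ⟨hac.trans_lt hpm.1, hpm.2.trans_le hdb⟩, hpm⟩

variable [FiniteDimensional ℝ E]

/-- The direction of a chord is close to the tangents along the chord. -/
theorem angle_chord_le (hf : LipschitzOnWith 1 f (Icc a b))
    (hS : ∀ᵐ x : ℝ, x ∈ Ioo a b → x ∈ S) (hunit : ∀ x ∈ S, ‖deriv f x‖ = 1)
    (hBV : BoundedVariationOn (deriv f) S) {c d p : ℝ} (hac : a ≤ c) (hcd : c < d) (hdb : d ≤ b)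
    (hp : p ∈ S) (hpm : p ∈ Ioo c d) :
    InnerProductGeometry.angle (f d - f c) (deriv f p) ≤
      Real.pi * (eVariationOn (deriv f) (S ∩ Icc c d)).toReal := by
  set W := (eVariationOn (deriv f) (S ∩ Icc c d)).toReal with hW
  have h0 : 0 < d - c := sub_pos.2 hcd
  have hf' : LipschitzOnWith 1 f (Icc c d) := hf.mono (Icc_subset_Icc hac hdb)
  -- The chord is the integral of the tangent, which differs from its value at `p` by at most the
  -- variation `W`.
  have hest : ‖(f d - f c) - (d - c) • deriv f p‖ ≤ W * (d - c) := by
    rw [← hf'.integral_deriv_eq_sub' hcd.le, ← intervalIntegral.integral_const,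
      ← intervalIntegral.integral_sub (hf'.intervalIntegrable_deriv' hcd.le)
        intervalIntegrable_const]
    have := intervalIntegral.norm_integral_le_of_norm_le_const_ae (a := c) (b := d) (C := W)
      (f := fun x => deriv f x - deriv f p) ?_
    · rwa [abs_of_pos h0] at this
    filter_upwards [ae_mem_Ioo_of_mem_uIoc hcd.le, hS] with x hx hxS hxm
    have hx' := hx hxm
    have hxS' := hxS ⟨hac.trans_lt hx'.1, hx'.2.trans_le hdb⟩
    rw [← dist_eq_norm]
    exact BoundedVariationOn.dist_le (hBV.mono inter_subset_left)
      ⟨hxS', Ioo_subset_Icc_self hx'⟩ ⟨hp, Ioo_subset_Icc_self hpm⟩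
  rw [← InnerProductGeometry.angle_smul_left_of_pos _ _ (inv_pos.2 h0)]
  refine angle_le_pi_mul_of_norm_sub_le (hunit p hp) ?_
  have : (d - c)⁻¹ • (f d - f c) - deriv f p
      = (d - c)⁻¹ • ((f d - f c) - (d - c) • deriv f p) := by
    rw [smul_sub _ (f d - f c), smul_smul, inv_mul_cancel₀ h0.ne', one_smul]
  rw [this, norm_smul, norm_inv, Real.norm_eq_abs, abs_of_pos h0, inv_mul_le_iff₀ h0, mul_comm]
  exact hest

/-- Inscribed polygons of a curve whose tangent has variation at most `C`. -/
theorem sum_angle_le_of_eVariationOn_deriv_le (hf : LipschitzOnWith 1 f (Icc a b))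
    (hS : ∀ᵐ x : ℝ, x ∈ Ioo a b → x ∈ S) (hunit : ∀ x ∈ S, ‖deriv f x‖ = 1)
    {C : ℝ} (hC : 0 ≤ C) (hBV : eVariationOn (deriv f) S ≤ ENNReal.ofReal C) {k : ℕ} {t : ℕ → ℝ}
    (ht : ∀ m ≤ k, t m < t (m + 1)) (h0 : a ≤ t 0) (hk : t (k + 1) ≤ b) :
    ∑ m ∈ Finset.range k, InnerProductGeometry.angle (f (t (m + 1)) - f (t m))
      (f (t (m + 2)) - f (t (m + 1))) ≤ 3 * Real.pi * C := by
  have hBV' : BoundedVariationOn (deriv f) S := (hBV.trans_lt ENNReal.ofReal_lt_top).ne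
  have hpi := Real.pi_pos
  -- Nothing is known of `t` beyond index `k + 1`; freezing it there gives a sequence monotone on
  -- all of `ℕ`.
  set t' : ℕ → ℝ := fun m => t (min m (k + 1)) with ht'
  have hmono : Monotone t' := monotone_nat_of_le_succ fun m => by
    rcases le_or_gt m k with hm | hm
    · simp only [ht']
      rw [min_eq_left (by lia), min_eq_left (by lia)]
      exact (ht m hm).le
    · simp only [ht']
      rw [min_eq_right (by lia), min_eq_right (by lia)]
  have htt : ∀ m ≤ k + 1, t' m = t m := fun m hm => by simp [ht', min_eq_left hm]
  have hab : ∀ m ≤ k + 1, a ≤ t m ∧ t m ≤ b := fun m hm => by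
    constructor
    · rw [← htt m hm]
      exact h0.trans ((htt 0 (by lia)).symm.le.trans (hmono (Nat.zero_le m)))
    · rw [← htt m hm]
      exact (hmono hm).trans ((htt _ le_rfl).le.trans hk)
  have hex : ∀ m, ∃ p, m ≤ k → p ∈ S ∧ p ∈ Ioo (t m) (t (m + 1)) := fun m => by
    by_cases hm : m ≤ k
    · obtain ⟨p, hp, hpm⟩ := exists_mem_Ioo_of_ae hS (hab m (by lia)).1 (ht m hm)
        (hab (m + 1) (by lia)).2
      exact ⟨p, fun _ => ⟨hp, hpm⟩⟩
    · exact ⟨0, fun h => absurd h hm⟩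
  choose p hp using hex
  set W : ℕ → ℝ := fun m => (eVariationOn (deriv f) (S ∩ Icc (t m) (t (m + 1)))).toReal with hW
  have hWsum : ∑ m ∈ Finset.range (k + 1), W m ≤ C := by
    have h1 : ∑ m ∈ Finset.range (k + 1), eVariationOn (deriv f) (S ∩ Icc (t m) (t (m + 1)))
        ≤ ENNReal.ofReal C := by
      refine le_trans (le_of_eq ?_) ((sum_eVariationOn_inter_Icc_le (deriv f) S hmono (k + 1)).trans
        ((eVariationOn.mono _ inter_subset_left).trans hBV))
      refine Finset.sum_congr rfl fun m hm => ?_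
      have := Finset.mem_range.1 hm
      rw [htt m (by lia), htt (m + 1) (by lia)]
    rw [hW, ← ENNReal.toReal_sum fun m _ => hBV'.mono inter_subset_left]
    exact ENNReal.toReal_le_of_le_ofReal hC h1
  have hW0 : ∀ m, 0 ≤ W m := fun m => ENNReal.toReal_nonneg
  have hTsum : ∑ m ∈ Finset.range k, ‖deriv f (p m) - deriv f (p (m + 1))‖ ≤ C := by
    have hpm : MonotoneOn p (Icc 0 k) := by
      refine monotoneOn_of_le_add_one ordConnected_Icc fun m _ h1 h2 => ?_
      have e1 := (hp m h1.2).2.2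
      have e2 := (hp (m + 1) h2.2).2.1
      linarith
    have h1 := eVariationOn.sum_le_of_monotoneOn_Icc (f := deriv f) (s := S) (m := 0) (n := k)
      hpm fun m hm => (hp m hm.2).1
    have h2 := h1.trans hBV
    rw [← ENNReal.ofReal_le_ofReal_iff hC, ENNReal.ofReal_sum_of_nonneg fun _ _ => norm_nonneg _]
    refine le_trans (le_of_eq ?_) h2
    rw [Nat.Ico_zero_eq_range]
    refine Finset.sum_congr rfl fun m _ => ?_
    rw [edist_dist, dist_comm, dist_eq_norm]
  have hang : ∀ m ≤ k, InnerProductGeometry.angle (f (t (m + 1)) - f (t m)) (deriv f (p m))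
      ≤ Real.pi * W m := fun m hm =>
    angle_chord_le hf hS hunit hBV' (hab m (by lia)).1 (ht m hm) (hab (m + 1) (by lia)).2
      (hp m hm).1 (hp m hm).2
  -- Triangle inequality for angles, from chord to tangent at `p m`, to tangent at `p (m + 1)`, to
  -- the next chord. Each of the three terms sums to at most `π * C`.
  have hstep : ∀ m ∈ Finset.range k, InnerProductGeometry.angle (f (t (m + 1)) - f (t m))
      (f (t (m + 2)) - f (t (m + 1))) ≤ Real.pi * W m
        + Real.pi * ‖deriv f (p m) - deriv f (p (m + 1))‖ + Real.pi * W (m + 1) := by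
    intro m hm
    have hm' := Finset.mem_range.1 hm
    have e1 := hang m hm'.le
    have e2 := hang (m + 1) hm'
    have e3 := angle_le_pi_mul_of_norm_sub_le (x := deriv f (p m))
      (hunit _ (hp (m + 1) hm').1) le_rfl
    rw [InnerProductGeometry.angle_comm] at e2
    have e4 := InnerProductGeometry.angle_le_angle_add_angle (f (t (m + 1)) - f (t m))
      (deriv f (p m)) (f (t (m + 2)) - f (t (m + 1)))
    have e5 := InnerProductGeometry.angle_le_angle_add_angle (deriv f (p m))
      (deriv f (p (m + 1))) (f (t (m + 2)) - f (t (m + 1)))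
    linarith
  refine (Finset.sum_le_sum hstep).trans ?_
  rw [Finset.sum_add_distrib, Finset.sum_add_distrib, ← Finset.mul_sum, ← Finset.mul_sum,
    ← Finset.mul_sum]
  have s1 : ∑ m ∈ Finset.range k, W m ≤ C := by
    rw [Finset.sum_range_succ] at hWsum; linarith [hW0 k]
  have s2 : ∑ m ∈ Finset.range k, W (m + 1) ≤ C := by
    rw [Finset.sum_range_succ'] at hWsum; linarith [hW0 0]
  nlinarith

/-- Converts a limit along the full-measure set `S` into the almost-everywhere limit required by the
fundamental theorem of calculus. -/
theorem inf_ae_le_nhdsWithin (hS : ∀ᵐ x : ℝ, x ∈ Ioo a b → x ∈ S) {x : ℝ} {R : Set ℝ}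
    (hx : Ioo a b ∈ 𝓝[R] x) : 𝓝[R] x ⊓ ae volume ≤ 𝓝[S ∩ R] x := by
  refine le_inf (inf_le_left.trans nhdsWithin_le_nhds) (le_principal_iff.2 ?_)
  have h1 : R ∩ Ioo a b ∈ 𝓝[R] x ⊓ ae volume := mem_inf_of_left (inter_mem self_mem_nhdsWithin hx)
  have h2 : {x | x ∈ Ioo a b → x ∈ S} ∈ 𝓝[R] x ⊓ ae volume := mem_inf_of_right hS
  filter_upwards [h1, h2] with y hy hy' using ⟨hy' hy.2, hy.1⟩

theorem LipschitzOnWith.eqOn_integral_deriv (hf : LipschitzOnWith 1 f (Icc a b)) :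
    EqOn f (fun x => f a + ∫ s in a..x, deriv f s) (Icc a b) := fun x hx => by
  simp only
  rw [(hf.mono (Icc_subset_Icc_right hx.2)).integral_deriv_eq_sub' hx.1]
  abel

/-- `f` is a primitive of `deriv f`, so a one-sided limit of the tangent along `S` is a one-sided
derivative, even at points where `f` has a corner. -/
theorem LipschitzOnWith.hasDerivWithinAt_Ici_of_tendsto (hf : LipschitzOnWith 1 f (Icc a b))
    (hS : ∀ᵐ x : ℝ, x ∈ Ioo a b → x ∈ S) {x : ℝ} (hx : x ∈ Ioo a b) {q : E}
    (hq : Tendsto (deriv f) (𝓝[S ∩ Ioi x] x) (𝓝 q)) : HasDerivWithinAt f q (Ici x) x := by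
  have hint := (hf.mono (Icc_subset_Icc_right hx.2.le)).intervalIntegrable_deriv' hx.1.le
  have := (integral_hasDerivWithinAt_of_tendsto_ae_right hint (s := Ici x) (t := Ioi x)
    ⟨univ, univ_mem, aestronglyMeasurable_deriv f _⟩
    (hq.mono_left (inf_ae_le_nhdsWithin hS (nhdsWithin_le_nhds (Ioo_mem_nhds hx.1 hx.2))))).const_add
      (f a)
  exact this.congr_of_eventuallyEq
    (eventually_of_mem (nhdsWithin_le_nhds (Icc_mem_nhds hx.1 hx.2)) hf.eqOn_integral_deriv)
    (hf.eqOn_integral_deriv (Ioo_subset_Icc_self hx))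

theorem LipschitzOnWith.hasDerivWithinAt_Iic_of_tendsto (hf : LipschitzOnWith 1 f (Icc a b))
    (hS : ∀ᵐ x : ℝ, x ∈ Ioo a b → x ∈ S) {x : ℝ} (hx : x ∈ Ioo a b) {q : E}
    (hq : Tendsto (deriv f) (𝓝[S ∩ Iio x] x) (𝓝 q)) : HasDerivWithinAt f q (Iic x) x := by
  have hint := (hf.mono (Icc_subset_Icc_right hx.2.le)).intervalIntegrable_deriv' hx.1.le
  have hq' : Tendsto (deriv f) (𝓝[S ∩ Iic x] x ⊓ ae volume) (𝓝 q) := by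
    refine hq.mono_left (le_inf (inf_le_left.trans nhdsWithin_le_nhds) (le_principal_iff.2 ?_))
    have h1 : S ∩ Iic x ∈ 𝓝[S ∩ Iic x] x ⊓ ae volume := mem_inf_of_left self_mem_nhdsWithin
    have h2 : {y : ℝ | y ≠ x} ∈ 𝓝[S ∩ Iic x] x ⊓ ae volume :=
      mem_inf_of_right (by
        have : ∀ᵐ y : ℝ, y ≠ x := by simp [ae_iff, measure_singleton]
        exact this)
    filter_upwards [h1, h2] with y hy hy' using ⟨hy.1, lt_of_le_of_ne hy.2 hy'⟩
  have hle : 𝓝[Iic x] x ⊓ ae volume ≤ 𝓝[S ∩ Iic x] x ⊓ ae volume :=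
    le_inf (inf_ae_le_nhdsWithin hS (nhdsWithin_le_nhds (Ioo_mem_nhds hx.1 hx.2))) inf_le_right
  have := (integral_hasDerivWithinAt_of_tendsto_ae_right hint (s := Iic x) (t := Iic x)
    ⟨univ, univ_mem, aestronglyMeasurable_deriv f _⟩ (hq'.mono_left hle)).const_add (f a)
  exact this.congr_of_eventuallyEq
    (eventually_of_mem (nhdsWithin_le_nhds (Icc_mem_nhds hx.1 hx.2)) hf.eqOn_integral_deriv)
    (hf.eqOn_integral_deriv (Ioo_subset_Icc_self hx))

/-- A curve whose tangent has bounded variation and no jumps is continuously differentiable. -/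
theorem contDiffOn_one_of_boundedVariationOn_deriv (hab : a < b)
    (hf : LipschitzOnWith 1 f (Icc a b)) (hSsub : S ⊆ Ioo a b)
    (hS : ∀ᵐ x : ℝ, x ∈ Ioo a b → x ∈ S) (hdiff : ∀ x ∈ S, DifferentiableAt ℝ f x)
    (hBV : BoundedVariationOn (deriv f) S)
    (hjump : ∀ x ∈ Ioo a b, ∀ p q : E, HasDerivWithinAt f p (Iic x) x →
      HasDerivWithinAt f q (Ici x) x → ∀ η > 0, ∃ δ > 0, ∀ y ∈ S, ∀ z ∈ S,
        x - δ < y → y < x → x < z → z < x + δ →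
          inner ℝ (q - p) (deriv f z - deriv f y) ≤ η) :
    ContDiffOn ℝ 1 f (Icc a b) := by
  have hlim : ∀ x ∈ Icc a b, ∃ l, Tendsto (deriv f) (𝓝[S] x) (𝓝 l) := by
    intro x hx
    obtain ⟨p, hp⟩ := hBV.exists_tendsto_left x
    obtain ⟨q, hq⟩ := hBV.exists_tendsto_right x
    rcases eq_or_lt_of_le hx.1 with rfl | hax
    · refine ⟨q, ?_⟩
      rwa [inter_eq_left.2 (show S ⊆ Ioi a from fun y hy => (hSsub hy).1)] at hq
    rcases eq_or_lt_of_le hx.2 with rfl | hxb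
    · refine ⟨p, ?_⟩
      rwa [inter_eq_left.2 (show S ⊆ Iio x from fun y hy => (hSsub hy).2)] at hp
    have hxo : x ∈ Ioo a b := ⟨hax, hxb⟩
    have dp := hf.hasDerivWithinAt_Iic_of_tendsto hS hxo hp
    have dq := hf.hasDerivWithinAt_Ici_of_tendsto hS hxo hq
    have hnp : (𝓝[S ∩ Iio x] x).NeBot := by
      rw [← mem_closure_iff_nhdsWithin_neBot, Metric.mem_closure_iff]
      intro ε hε
      obtain ⟨y, hy, hym⟩ := exists_mem_Ioo_of_ae hS (le_max_left a (x - ε))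
        (max_lt hax (by linarith)) hxb.le
      refine ⟨y, ⟨hy, hym.2⟩, ?_⟩
      rw [Real.dist_eq, abs_of_pos (sub_pos.2 hym.2)]
      linarith [(max_lt_iff.1 hym.1).2]
    have hnq : (𝓝[S ∩ Ioi x] x).NeBot := by
      rw [← mem_closure_iff_nhdsWithin_neBot, Metric.mem_closure_iff]
      intro ε hε
      obtain ⟨y, hy, hym⟩ := exists_mem_Ioo_of_ae hS hax.le
        (lt_min hxb (by linarith : x < x + ε)) (min_le_left _ _)
      refine ⟨y, ⟨hy, hym.1⟩, ?_⟩
      rw [dist_comm, Real.dist_eq, abs_of_pos (sub_pos.2 hym.1)]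
      linarith [(lt_min_iff.1 hym.2).2]
    have hpq : q = p := by
      -- Letting `y` and `z` tend to `x` from the two sides turns `hjump` into a bound on the
      -- squared jump.
      have key : ∀ η > 0, inner ℝ (q - p) (q - p) ≤ η := by
        intro η hη
        obtain ⟨δ, hδ, h⟩ := hjump x hxo p q dp dq η hη
        have ht : Tendsto (fun yz : ℝ × ℝ => inner ℝ (q - p) (deriv f yz.2 - deriv f yz.1))
            (𝓝[S ∩ Iio x] x ×ˢ 𝓝[S ∩ Ioi x] x) (𝓝 (inner ℝ (q - p) (q - p))) :=
          tendsto_const_nhds.inner ((hq.comp tendsto_snd).sub (hp.comp tendsto_fst))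
        refine le_of_tendsto ht ?_
        have e1 : ∀ᶠ y in 𝓝[S ∩ Iio x] x, (y ∈ S ∧ y < x) ∧ x - δ < y :=
          (eventually_mem_nhdsWithin).and
            (nhdsWithin_le_nhds (Ioi_mem_nhds (by linarith)))
        have e2 : ∀ᶠ z in 𝓝[S ∩ Ioi x] x, (z ∈ S ∧ x < z) ∧ z < x + δ :=
          (eventually_mem_nhdsWithin).and
            (nhdsWithin_le_nhds (Iio_mem_nhds (by linarith)))
        filter_upwards [e1.prod_mk e2] with yz hyz
        exact h _ hyz.1.1.1 _ hyz.2.1.1 hyz.1.2 hyz.1.1.2 hyz.2.1.2 hyz.2.2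
      have : inner ℝ (q - p) (q - p) ≤ 0 := le_of_forall_pos_le_add fun η hη => by
        simpa using key η hη
      rw [real_inner_self_eq_norm_sq] at this
      exact sub_eq_zero.1 (norm_eq_zero.1 (pow_eq_zero_iff two_ne_zero |>.1
        (le_antisymm this (sq_nonneg _))))
    subst hpq
    refine ⟨q, ?_⟩
    have hsplit : S ⊆ (S ∩ Iio x ∪ S ∩ Ioi x) ∪ (S ∩ {x}) := by
      intro y hy
      rcases lt_trichotomy y x with h | h | h
      · exact Or.inl (Or.inl ⟨hy, h⟩)
      · exact Or.inr ⟨hy, h⟩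
      · exact Or.inl (Or.inr ⟨hy, h⟩)
    refine Tendsto.mono_left ?_ (nhdsWithin_mono x hsplit)
    rw [nhdsWithin_union, nhdsWithin_union]
    refine (hp.sup hq).sup ?_
    -- The limit along `S` must also account for the value at `x` itself; if `x ∈ S`, then `f` is
    -- differentiable there and its derivative is the right derivative `q`.
    by_cases hxS : x ∈ S
    · rw [inter_eq_right.2 (singleton_subset_iff.2 hxS), nhdsWithin_singleton]
      have hu : deriv f x = q :=
        (uniqueDiffWithinAt_Ici x).eq_deriv _ (hdiff x hxS).hasDerivAt.hasDerivWithinAt dq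
      rw [← hu]
      exact tendsto_pure_nhds _ _
    · rw [inter_singleton_eq_empty.2 hxS, nhdsWithin_empty]
      exact tendsto_bot
  have hcl : Icc a b ⊆ closure S := by
    rw [← closure_Ioo hab.ne]
    refine closure_minimal (fun x hx => ?_) isClosed_closure
    rw [Metric.mem_closure_iff]
    intro ε hε
    obtain ⟨y, hy, hym⟩ := exists_mem_Ioo_of_ae hS hx.1.le
      (lt_min hx.2 (by linarith : x < x + ε)) (min_le_left _ _)
    refine ⟨y, hy, ?_⟩
    rw [dist_comm, Real.dist_eq, abs_of_pos (sub_pos.2 hym.1)]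
    linarith [(lt_min_iff.1 hym.2).2]
  have hcont : ContinuousOn (extendFrom S (deriv f)) (Icc a b) := continuousOn_extendFrom hcl hlim
  -- A continuous function agreeing with `deriv f` almost everywhere on `[a, b]`; hence `f` is a
  -- primitive of it.
  set τ : ℝ → E := IccExtend hab.le ((Icc a b).domRestrict (extendFrom S (deriv f))) with hτ
  have hτc : Continuous τ := (continuousOn_iff_continuous_domRestrict.1 hcont).Icc_extend'
  have hτeq : ∀ x ∈ S, τ x = deriv f x := by
    intro x hx
    have hxI := Ioo_subset_Icc_self (hSsub hx)
    rw [hτ, IccExtend_of_mem _ _ hxI, domRestrict_apply]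
    obtain ⟨l, hl⟩ := hlim x hxI
    have : l = deriv f x :=
      tendsto_nhds_unique (hl.mono_left (pure_le_nhdsWithin hx)) (tendsto_pure_nhds _ _)
    exact extendFrom_eq (hcl hxI) (this ▸ hl)
  have hG : ∀ x, HasDerivAt (fun x => f a + ∫ s in a..x, τ s) (τ x) x := fun x =>
    (hτc.integral_hasStrictDerivAt a x).hasDerivAt.const_add _
  have hGC : ContDiff ℝ 1 (fun x => f a + ∫ s in a..x, τ s) := by
    rw [contDiff_one_iff_deriv]
    exact ⟨fun x => (hG x).differentiableAt, by rwa [funext fun x => (hG x).deriv]⟩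
  refine hGC.contDiffOn.congr fun x hx => ?_
  rw [hf.eqOn_integral_deriv hx]
  refine congrArg (f a + ·) ?_
  refine integral_congr_ae ?_
  filter_upwards [ae_mem_Ioo_of_mem_uIoc hx.1, hS] with y hy hyS hym
  have := hy hym
  exact (hτeq y (hyS ⟨this.1, this.2.trans_le hx.2⟩)).symm

end BoundedVariationTangent

/-! ### One-sided derivatives and infima. -/

/-- Since `0 ≤ c`, the default value `0` of a nonexistent derivative also satisfies the bound;
existence of the one-sided variations of the constraints never has to be proved. -/
theorem neg_le_derivWithin_Ici {F : ℝ → ℝ} {c : ℝ} (hc : 0 ≤ c)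
    (h : ∀ᶠ t in 𝓝[>] (0 : ℝ), F 0 - c * t ≤ F t) : -c ≤ derivWithin F (Ici 0) 0 := by
  by_cases hd : DifferentiableWithinAt ℝ F (Ici 0) 0
  · have h1 := hd.hasDerivWithinAt.Ioi_of_Ici
    rw [hasDerivWithinAt_iff_tendsto_slope' (by simp)] at h1
    refine ge_of_tendsto h1 ?_
    filter_upwards [h, self_mem_nhdsWithin] with t ht ht0
    have ht0' : (0 : ℝ) < t := ht0
    rw [slope_def_field, sub_zero, le_div_iff₀ ht0']
    linarith
  · rw [derivWithin_zero_of_not_differentiableWithinAt hd]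
    linarith

/-- The empty family, with `sInf ∅ = 0`, is the case of an absent constraint. -/
theorem sInf_image_sub_le {ι : Type*} {u w : ι → ℝ} {p : Set ι} {κ : ℝ} (hκ : 0 ≤ κ)
    (h : ∀ x ∈ p, sInf (u '' p) - κ ≤ w x) : sInf (u '' p) - κ ≤ sInf (w '' p) := by
  rcases p.eq_empty_or_nonempty with rfl | hp
  · simpa using hκ
  · refine le_csInf (hp.image w) ?_
    rintro _ ⟨x, hx, rfl⟩
    exact h x hx

theorem nonneg_of_hasDerivWithinAt_Ici {u : ℝ → ℝ} {x q : ℝ} (h : HasDerivWithinAt u q (Ici x) x)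
    (hmin : ∀ᶠ y in 𝓝 x, u x ≤ u y) : 0 ≤ q := by
  have h1 := h.Ioi_of_Ici
  rw [hasDerivWithinAt_iff_tendsto_slope' (by simp)] at h1
  refine ge_of_tendsto h1 ?_
  filter_upwards [nhdsWithin_le_nhds hmin, self_mem_nhdsWithin] with y hy hxy
  rw [slope_def_field]
  exact div_nonneg (sub_nonneg.2 hy) (sub_nonneg.2 (le_of_lt hxy))

theorem nonpos_of_hasDerivWithinAt_Iic {u : ℝ → ℝ} {x q : ℝ} (h : HasDerivWithinAt u q (Iic x) x)
    (hmin : ∀ᶠ y in 𝓝 x, u x ≤ u y) : q ≤ 0 := by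
  have h1 := h.Iio_of_Iic
  rw [hasDerivWithinAt_iff_tendsto_slope' (by simp)] at h1
  refine le_of_tendsto h1 ?_
  filter_upwards [nhdsWithin_le_nhds hmin, self_mem_nhdsWithin] with y hy hxy
  rw [slope_def_field]
  exact div_nonpos_of_nonneg_of_nonpos (sub_nonneg.2 hy) (sub_nonpos.2 (le_of_lt hxy))

/-- At a point of a curve where a function attains a minimum, its derivative in the direction of
the jump of the tangent is nonnegative. -/
theorem fderiv_sub_nonneg_of_min {E : Type*} [NormedAddCommGroup E] [NormedSpace ℝ E]
    {G : E → ℝ} {G' : E →L[ℝ] ℝ} {f : ℝ → E} {x : ℝ} {p q : E} (hG : HasFDerivAt G G' (f x))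
    (hp : HasDerivWithinAt f p (Iic x) x) (hq : HasDerivWithinAt f q (Ici x) x)
    (hmin : ∀ᶠ y in 𝓝 x, G (f x) ≤ G (f y)) : 0 ≤ G' (q - p) := by
  have h1 := nonneg_of_hasDerivWithinAt_Ici (hG.comp_hasDerivWithinAt x hq) hmin
  have h2 := nonpos_of_hasDerivWithinAt_Iic (hG.comp_hasDerivWithinAt x hp) hmin
  rw [map_sub]
  linarith

/-! ### Fields supported in a fundamental domain, and the first variation inequality. -/

namespace GeneralizedLink

variable {N : ℕ} (L : GeneralizedLink N) {i : Fin N} {a b : ℝ}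

/-- `[a, b]` is a fundamental domain of the component `i`. -/
structure IsWindow (i : Fin N) (a b : ℝ) : Prop where
  sub_eq : b - a = L.len i
  start_eq : ¬ L.closed i → a = 0

variable {L}

theorem IsWindow.lt (h : L.IsWindow i a b) : a < b := by
  have := L.len_pos i
  linarith [h.sub_eq]

theorem IsWindow.Icc_subset_dom (h : L.IsWindow i a b) : Icc a b ⊆ L.dom i := by
  intro s hs hc
  have h1 := h.start_eq hc
  have h2 := h.sub_eq
  rw [h1] at h2 hs
  rwa [← h2, sub_zero]

theorem isWindow_zero (i : Fin N) : L.IsWindow i 0 (L.len i) := ⟨sub_zero _, fun _ => rfl⟩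

theorem eVariationOn_eq {x y : ℝ} (h : Icc x y ⊆ L.dom i) (hxy : x ≤ y) :
    eVariationOn (L.γ i) (Icc x y) = ENNReal.ofReal (y - x) := by
  have := L.unitSpeed i (h ⟨le_rfl, hxy⟩) (h ⟨hxy, le_rfl⟩)
  change eVariationOn (L.γ i) (L.dom i ∩ Icc x y) = _ at this
  rwa [inter_eq_right.2 h, NNReal.coe_one, one_mul] at this

theorem IsWindow.lipschitzOnWith (h : L.IsWindow i a b) : LipschitzOnWith 1 (L.γ i) (Icc a b) := by
  refine LipschitzOnWith.of_dist_le_mul fun x hx y hy => ?_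
  wlog hxy : x ≤ y generalizing x y
  · rw [dist_comm, dist_comm x]
    exact this y hy x hx (le_of_not_ge hxy)
  have h1 := eVariationOn.edist_le (L.γ i) (s := Icc x y) ⟨le_rfl, hxy⟩ ⟨hxy, le_rfl⟩
  rw [eVariationOn_eq ((Icc_subset_Icc hx.1 hy.2).trans h.Icc_subset_dom) hxy, edist_dist,
    ENNReal.ofReal_le_ofReal_iff (sub_nonneg.2 hxy)] at h1
  rwa [NNReal.coe_one, one_mul, dist_comm x, Real.dist_eq, abs_of_nonneg (sub_nonneg.2 hxy)]

theorem IsWindow.length_eq (h : L.IsWindow i a b) :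
    (eVariationOn (L.γ i) (Icc a b)).toReal = b - a := by
  rw [eVariationOn_eq h.Icc_subset_dom h.lt.le, ENNReal.toReal_ofReal (sub_nonneg.2 h.lt.le)]

variable (L) in
open Classical in
/-- The vector field along `L` that is `φ` on the window `[a, a + len i]` of the component `i` and
zero on the other components. -/
noncomputable def extendField (i : Fin N) (a : ℝ) (φ : ℝ → E3) (j : Fin N) (s : ℝ) : E3 :=
  if j = i then (if L.closed i then φ (toIocMod (L.len_pos i) a s) else φ s) else 0

theorem extendField_of_ne {φ : ℝ → E3} {j : Fin N} (h : j ≠ i) :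
    L.extendField i a φ j = 0 := by
  ext1 s; simp [extendField, h]

theorem extendField_of_closed {φ : ℝ → E3} (h : L.closed i) :
    L.extendField i a φ i = fun s => φ (toIocMod (L.len_pos i) a s) := by
  ext1 s; simp [extendField, h]

theorem extendField_of_not_closed {φ : ℝ → E3} (h : ¬ L.closed i) :
    L.extendField i a φ i = φ := by
  ext1 s; simp [extendField, h]

theorem extendField_smul (φ : ℝ → E3) (c : ℝ) (j : Fin N) (s : ℝ) :
    L.extendField i a (fun r => c • φ r) j s = c • L.extendField i a φ j s := by
  unfold extendField
  split_ifs <;> simp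

/-- The interval extends past the seam `a + p`, so it is a neighbourhood of every point of a period.
Beyond the seam both sides vanish: `s - n * p` exceeds `d`, and its reduction is below `c`. -/
theorem toIocMod_periodization_eq {E : Type*} [Zero E] {p : ℝ} (hp : 0 < p) {φ : ℝ → E} {c d : ℝ}
    (hd : d < a + p) (hφ : ∀ r, r ∉ Icc c d → φ r = 0) (n : ℤ) {s : ℝ}
    (hs : s - n * p ∈ Ioo a (min c (a + p) + p)) :
    φ (toIocMod hp a s) = φ (s - n * p) := by
  have h1 := min_le_left c (a + p)
  have h2 := min_le_right c (a + p)
  rcases le_or_gt (s - n * p) (a + p) with h | h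
  · have : toIocMod hp a s = s - n * p :=
      (toIocMod_eq_iff hp).2 ⟨⟨hs.1, h⟩, n, by simp⟩
    rw [this]
  · have : toIocMod hp a s = s - n * p - p :=
      (toIocMod_eq_iff hp).2 ⟨⟨by linarith, by linarith [hs.2]⟩, n + 1, by simp; ring⟩
    rw [this, hφ _ fun hm => by linarith [hm.1, hs.2], hφ _ fun hm => by linarith [hm.2]]

theorem contDiff_periodization {p : ℝ} (hp : 0 < p) {φ : ℝ → E3} (hφ : ContDiff ℝ ∞ φ)
    (hsupp : SupportedIn φ a (a + p)) : ContDiff ℝ ∞ fun s => φ (toIocMod hp a s) := by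
  obtain ⟨c, d, hc, hd, h0⟩ := hsupp
  rw [contDiff_iff_contDiffAt]
  intro s
  set n := toIocDiv hp a s with hn
  have hs : s - n * p ∈ Ioc a (a + p) := by
    have := sub_toIocDiv_zsmul_mem_Ioc hp a s
    rwa [zsmul_eq_mul] at this
  have hs' : s - n * p ∈ Ioo a (min c (a + p) + p) :=
    ⟨hs.1, hs.2.trans_lt (by linarith [lt_min hc (by linarith : a < a + p)])⟩
  have hcont : ContinuousAt (fun r : ℝ => r - n * p) s := by fun_prop
  have hev : (fun s => φ (toIocMod hp a s)) =ᶠ[𝓝 s] fun s => φ (s - n * p) := by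
    filter_upwards [hcont.preimage_mem_nhds (Ioo_mem_nhds hs'.1 hs'.2)] with r hr
    exact toIocMod_periodization_eq hp hd h0 n hr
  exact ((hφ.comp (contDiff_id.sub contDiff_const)).contDiffAt).congr_of_eventuallyEq hev

section Extension

variable {φ : ℝ → E3}

theorem IsWindow.eq_add (h : L.IsWindow i a b) : b = a + L.len i := by linarith [h.sub_eq]

theorem contDiff_extendField (h : L.IsWindow i a b) (hφ : ContDiff ℝ ∞ φ)
    (hsupp : SupportedIn φ a b) (j : Fin N) : ContDiff ℝ ∞ (L.extendField i a φ j) := by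
  by_cases hj : j = i
  · subst hj
    by_cases hc : L.closed j
    · rw [extendField_of_closed hc]
      exact contDiff_periodization (L.len_pos j) hφ (h.eq_add ▸ hsupp)
    · rwa [extendField_of_not_closed hc]
  · rw [extendField_of_ne hj]
    exact contDiff_const

theorem extendField_periodic (hc : L.closed i) :
    Function.Periodic (L.extendField i a φ i) (L.len i) := by
  rw [extendField_of_closed hc]
  intro s
  simp

theorem isSmoothField_extendField (h : L.IsWindow i a b) (hφ : ContDiff ℝ ∞ φ)
    (hsupp : SupportedIn φ a b) : L.IsSmoothField (L.extendField i a φ) := by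
  intro j
  refine ⟨(contDiff_extendField h hφ hsupp j).contDiffOn, fun hc => ?_⟩
  by_cases hj : j = i
  · subst hj
    exact extendField_periodic hc
  · rw [extendField_of_ne hj]
    exact fun _ => rfl

theorem isCompatible_extendField (h : L.IsWindow i a b) (hsupp : SupportedIn φ a b) :
    L.IsCompatible (L.extendField i a φ) := by
  intro j hc
  by_cases hj : j = i
  · subst hj
    rw [extendField_of_not_closed hc]
    obtain ⟨c, d, hac, hdb, h0⟩ := hsupp
    have ha := h.start_eq hc
    have hb := h.eq_add
    rw [ha, zero_add] at hb
    rw [h0 0 fun hm => by linarith [hm.1], h0 (L.len j) fun hm => by linarith [hm.2]]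
    exact ⟨Submodule.zero_mem _, Submodule.zero_mem _⟩
  · rw [extendField_of_ne hj]
    exact ⟨Submodule.zero_mem _, Submodule.zero_mem _⟩

/-- Each point of the component, with its vector, is seen in the window. -/
theorem exists_mem_window (φ : ℝ → E3) (h : L.IsWindow i a b) {s : ℝ}
    (hs : s ∈ Icc 0 (L.len i)) :
    ∃ r ∈ Icc a b, L.γ i s = L.γ i r ∧ L.extendField i a φ i s = φ r := by
  by_cases hc : L.closed i
  · refine ⟨toIocMod (L.len_pos i) a s, ?_, ?_, by rw [extendField_of_closed hc]⟩
    · rw [h.eq_add]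
      exact Ioc_subset_Icc_self (toIocMod_mem_Ioc _ _ _)
    · rw [toIocMod, (L.periodic i hc).sub_zsmul_eq]
  · rw [extendField_of_not_closed hc]
    refine ⟨s, ?_, rfl, rfl⟩
    have ha := h.start_eq hc
    have hb := h.eq_add
    rw [ha, zero_add] at hb
    rwa [ha, hb]

theorem IsWindow.exists_mem_Icc (h : L.IsWindow i a b) {r : ℝ} (hr : r ∈ Icc a b) :
    ∃ s ∈ Icc 0 (L.len i), L.γ i r = L.γ i s := by
  by_cases hc : L.closed i
  · refine ⟨toIocMod (L.len_pos i) 0 r, ?_, ?_⟩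
    · have := toIocMod_mem_Ioc (L.len_pos i) 0 r
      rw [zero_add] at this
      exact Ioc_subset_Icc_self this
    · rw [toIocMod, (L.periodic i hc).sub_zsmul_eq]
  · have ha := h.start_eq hc
    have hb := h.eq_add
    rw [ha, zero_add] at hb
    exact ⟨r, by rwa [ha, hb] at hr, rfl⟩

theorem _root_.Function.Periodic.deriv' {g : ℝ → E3} {p : ℝ} (hg : Function.Periodic g p) :
    Function.Periodic (deriv g) p := fun x => by
  rw [← deriv_comp_add_const, funext hg]

/-- On a circle the integrand is periodic, so its integral may be taken over any window; on an arc
the window is `[0, len i]` already. -/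
theorem integral_inner_deriv_extendField (φ : ℝ → E3) (h : L.IsWindow i a b) :
    ∫ s in 0..(L.len i), inner ℝ (deriv (L.γ i) s) (deriv (L.extendField i a φ i) s) =
      ∫ s in a..b, inner ℝ (deriv (L.γ i) s) (deriv φ s) := by
  by_cases hc : L.closed i
  · have hper : Function.Periodic
        (fun s => inner ℝ (deriv (L.γ i) s) (deriv (L.extendField i a φ i) s)) (L.len i) := by
      intro s
      simp only
      rw [(L.periodic i hc).deriv' s, (extendField_periodic hc).deriv' s]
    have := hper.intervalIntegral_add_eq 0 a
    rw [zero_add, ← h.eq_add] at this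
    rw [this]
    refine integral_congr_ae ?_
    filter_upwards [ae_mem_Ioo_of_mem_uIoc h.lt.le] with s hs hsm
    have hs' := hs hsm
    congr 1
    refine Filter.EventuallyEq.deriv_eq ?_
    filter_upwards [Ioo_mem_nhds hs'.1 hs'.2] with r hr
    rw [extendField_of_closed hc]
    simp only
    rw [(toIocMod_eq_self _).2]
    rw [← h.eq_add]
    exact Ioo_subset_Ioc_self hr
  · have ha := h.start_eq hc
    have hb := h.eq_add
    rw [ha, zero_add] at hb
    rw [extendField_of_not_closed hc, ha, hb]

theorem deltaLength_extendField (h : L.IsWindow i a b) (hφ : ContDiff ℝ ∞ φ)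
    (hsupp : SupportedIn φ a b) :
    L.deltaLength (L.extendField i a φ) =
      ∫ s in a..b, inner ℝ (deriv (L.γ i) s) (deriv φ s) := by
  have h1 : ∀ j, HasDerivAt
      (fun t : ℝ => (eVariationOn (fun s => L.γ j s + t • L.extendField i a φ j s)
        (Icc 0 (L.len j))).toReal)
      (∫ s in 0..(L.len j), inner ℝ (deriv (L.γ j) s) (deriv (L.extendField i a φ j) s)) 0 :=
    fun j => hasDerivAt_length_add_smul (L.len_pos j).le (isWindow_zero j).lipschitzOnWith
      (isWindow_zero j).length_eq (contDiff_extendField h hφ hsupp j)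
  have h2 := (HasDerivAt.fun_sum fun j (_ : j ∈ Finset.univ) => h1 j).deriv
  rw [← integral_inner_deriv_extendField φ h]
  rw [Finset.sum_eq_single i] at h2
  · exact h2
  · intro j _ hj
    rw [extendField_of_ne hj]
    simp
  · simp

end Extension

/-- The first variation inequality: if the constraints decrease at rate at most `c`, then the
length does not decrease much faster. -/
theorem StronglyCritical.exists_forall_neg_le (hL : L.StronglyCritical) :
    ∃ ε > 0, ∀ {i : Fin N} {a b : ℝ}, L.IsWindow i a b → ∀ {φ : ℝ → E3}, ContDiff ℝ ∞ φ →
      SupportedIn φ a b → ∀ {c : ℝ}, 0 ≤ c →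
      (∀ᶠ t in 𝓝[>] (0 : ℝ),
        L.thickness L.γ - c * t ≤ L.thickness (L.vary (L.extendField i a φ) t)) →
      (∀ᶠ t in 𝓝[>] (0 : ℝ),
        L.obstacleMin L.γ - c * t ≤ L.obstacleMin (L.vary (L.extendField i a φ) t)) →
      -∫ s in a..b, inner ℝ (deriv (L.γ i) s) (deriv φ s) ≤ c / ε := by
  obtain ⟨ε, hε, H⟩ := hL
  refine ⟨ε, hε, fun {i a b} h {φ} hφ hsupp {c} hc hthi hobs => ?_⟩
  set D := ∫ s in a..b, inner ℝ (deriv (L.γ i) s) (deriv φ s) with hD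
  rcases le_or_gt 0 D with hD0 | hD0
  · have := div_nonneg hc hε.le
    linarith
  -- Normalizes the field to `deltaLength = -1`. Scaling the field is scaling time, so the
  -- constraints now decrease at rate at most `c * l`, and criticality gives `ε ≤ c * l`.
  set l : ℝ := (-D)⁻¹ with hl
  have hl0 : 0 < l := inv_pos.2 (neg_pos.2 hD0)
  have hφl : ContDiff ℝ ∞ fun r => l • φ r := hφ.const_smul l
  have hsuppl : SupportedIn (fun r => l • φ r) a b := by
    obtain ⟨x, y, hx, hy, h0⟩ := hsupp
    exact ⟨x, y, hx, hy, fun r hr => by simp only; rw [h0 r hr, smul_zero]⟩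
  have hvary : ∀ t, L.vary (L.extendField i a fun r => l • φ r) t
      = L.vary (L.extendField i a φ) (l * t) := by
    intro t
    ext j s : 2
    simp only [vary, extendField_smul, smul_smul, mul_comm l t]
  have hvary0 : L.vary (L.extendField i a fun r => l • φ r) 0 = L.γ := by
    ext j s : 2
    simp [vary]
  have htend : Tendsto (fun t => l * t) (𝓝[>] (0 : ℝ)) (𝓝[>] (0 : ℝ)) := by
    refine tendsto_nhdsWithin_iff.2 ⟨?_, ?_⟩
    · have : Tendsto (fun t => l * t) (𝓝 (0 : ℝ)) (𝓝 (l * 0)) := tendsto_id.const_mul l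
      rw [mul_zero] at this
      exact this.mono_left nhdsWithin_le_nhds
    · filter_upwards [self_mem_nhdsWithin] with t ht
      exact mul_pos hl0 ht
  have hlen : L.deltaLength (L.extendField i a fun r => l • φ r) = -1 := by
    rw [deltaLength_extendField h hφl hsuppl]
    have : ∀ s, inner ℝ (deriv (L.γ i) s) (deriv (fun r => l • φ r) s)
        = l * inner ℝ (deriv (L.γ i) s) (deriv φ s) := by
      intro s
      rw [(((hφ.differentiable (by simp)) s).hasDerivAt.fun_const_smul l).deriv, inner_smul_right]
    simp_rw [this]
    rw [intervalIntegral.integral_const_mul, ← hD, hl]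
    have := hD0.ne
    field_simp
  have h1 := H _ (isSmoothField_extendField h hφl hsuppl) (isCompatible_extendField h hsuppl) hlen
  have hcl : 0 ≤ c * l := mul_nonneg hc hl0.le
  have h2 : -(c * l) ≤ L.deltaThickness (L.extendField i a fun r => l • φ r) := by
    refine neg_le_derivWithin_Ici hcl ?_
    filter_upwards [htend.eventually hthi] with t ht
    rw [hvary0, hvary]
    linarith
  have h3 : -(c * l) ≤ L.deltaObstacle (L.extendField i a fun r => l • φ r) := by
    refine neg_le_derivWithin_Ici hcl ?_
    filter_upwards [htend.eventually hobs] with t ht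
    rw [hvary0, hvary]
    linarith
  have h4 : ε ≤ c * l := by linarith [le_min h2 h3]
  rw [hl, ← div_eq_mul_inv, le_div_iff₀ (neg_pos.2 hD0)] at h4
  rw [le_div_iff₀ hε]
  linarith

end GeneralizedLink

/-! ### Estimates for the constraints and regularity of critical links. -/

namespace GeneralizedLink

variable {N : ℕ} {L : GeneralizedLink N} {i : Fin N} {a b : ℝ}

theorem thickness_le {j k : Fin N} (hjk : j ≠ k) {s t : ℝ} (hs : s ∈ Icc 0 (L.len j))
    (ht : t ∈ Icc 0 (L.len k)) : L.thickness L.γ ≤ dist (L.γ j s) (L.γ k t) :=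
  csInf_le ⟨0, by rintro _ ⟨_, _, _, _, _, _, _, rfl⟩; exact dist_nonneg⟩
    ⟨j, k, hjk, s, hs, t, ht, rfl⟩

theorem obstacleMin_le {j : Fin N} (o : Fin (L.numObst j)) {s : ℝ} (hs : s ∈ Icc 0 (L.len j)) :
    L.obstacleMin L.γ ≤ L.g j o (L.γ j s) :=
  csInf_le ⟨0, by rintro _ ⟨j, o, s, hs, rfl⟩; exact L.g_nonneg j o s hs⟩ ⟨j, o, s, hs, rfl⟩

theorem thickness_sub_le {f : Fin N → ℝ → E3} {κ : ℝ} (hκ : 0 ≤ κ)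
    (h : ∀ j k, j ≠ k → ∀ s ∈ Icc 0 (L.len j), ∀ t ∈ Icc 0 (L.len k),
      L.thickness L.γ - κ ≤ dist (f j s) (f k t)) :
    L.thickness L.γ - κ ≤ L.thickness f := by
  set p : Set (Fin N × Fin N × ℝ × ℝ) :=
    {x | x.1 ≠ x.2.1 ∧ x.2.2.1 ∈ Icc 0 (L.len x.1) ∧ x.2.2.2 ∈ Icc 0 (L.len x.2.1)} with hp
  have heq : ∀ f : Fin N → ℝ → E3, L.thickness f =
      sInf ((fun x : Fin N × Fin N × ℝ × ℝ => dist (f x.1 x.2.2.1) (f x.2.1 x.2.2.2)) '' p) := by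
    intro f
    unfold thickness
    congr 1
    ext d
    constructor
    · rintro ⟨j, k, hjk, s, hs, t, ht, rfl⟩
      exact ⟨(j, k, s, t), ⟨hjk, hs, ht⟩, rfl⟩
    · rintro ⟨⟨j, k, s, t⟩, ⟨hjk, hs, ht⟩, rfl⟩
      exact ⟨j, k, hjk, s, hs, t, ht, rfl⟩
  rw [heq f, heq L.γ]
  refine sInf_image_sub_le hκ fun x hx => ?_
  rw [← heq L.γ]
  exact h _ _ hx.1 _ hx.2.1 _ hx.2.2

theorem obstacleMin_sub_le {f : Fin N → ℝ → E3} {κ : ℝ} (hκ : 0 ≤ κ)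
    (h : ∀ j, ∀ o : Fin (L.numObst j), ∀ s ∈ Icc 0 (L.len j),
      L.obstacleMin L.γ - κ ≤ L.g j o (f j s)) :
    L.obstacleMin L.γ - κ ≤ L.obstacleMin f := by
  set p : Set ((Σ j, Fin (L.numObst j)) × ℝ) := {x | x.2 ∈ Icc 0 (L.len x.1.1)} with hp
  have heq : ∀ f : Fin N → ℝ → E3, L.obstacleMin f =
      sInf ((fun x : (Σ j, Fin (L.numObst j)) × ℝ => L.g x.1.1 x.1.2 (f x.1.1 x.2)) '' p) := by
    intro f
    unfold obstacleMin
    congr 1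
    ext d
    constructor
    · rintro ⟨j, o, s, hs, rfl⟩
      exact ⟨(⟨j, o⟩, s), hs, rfl⟩
    · rintro ⟨⟨⟨j, o⟩, s⟩, hs, rfl⟩
      exact ⟨j, o, s, hs, rfl⟩
  rw [heq f, heq L.γ]
  refine sInf_image_sub_le hκ fun x hx => ?_
  rw [← heq L.γ]
  exact h _ _ _ hx

theorem continuousOn_γ (i : Fin N) : ContinuousOn (L.γ i) (Icc 0 (L.len i)) :=
  (isWindow_zero i).lipschitzOnWith.continuousOn

variable (L) in
/-- The obstacle functions are uniformly Lipschitz near the link. -/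
theorem exists_obstacle_lipschitz : ∃ K : ℝ, 0 ≤ K ∧ ∀ j, ∀ o : Fin (L.numObst j),
    ∀ s ∈ Icc 0 (L.len j), ∀ w : E3, ‖w‖ ≤ 1 →
      L.g j o (L.γ j s) - K * ‖w‖ ≤ L.g j o (L.γ j s + w) := by
  have key : ∀ x : Σ j, Fin (L.numObst j), ∃ K : ℝ, 0 ≤ K ∧
      ∀ s ∈ Icc 0 (L.len x.1), ∀ w : E3, ‖w‖ ≤ 1 →
      L.g x.1 x.2 (L.γ x.1 s) - K * ‖w‖ ≤ L.g x.1 x.2 (L.γ x.1 s + w) := by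
    rintro ⟨j, o⟩
    obtain ⟨R, hR⟩ := (isCompact_Icc.image_of_continuousOn
      (continuousOn_γ (L := L) j)).isBounded.exists_norm_le
    -- Radius `R + 1` leaves room for displacements `w` of norm at most `1`.
    obtain ⟨K, hK⟩ := (L.g_contDiff j o).contDiffOn.exists_lipschitzOnWith (by decide)
      (convex_closedBall (0 : E3) (R + 1)) (isCompact_closedBall _ _)
    refine ⟨K, K.2, fun s hs w hw => ?_⟩
    have hn : ‖L.γ j s‖ ≤ R := hR _ (mem_image_of_mem _ hs)
    have h1 : L.γ j s ∈ Metric.closedBall (0 : E3) (R + 1) := by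
      rw [mem_closedBall_zero_iff]; linarith
    have h2 : L.γ j s + w ∈ Metric.closedBall (0 : E3) (R + 1) := by
      rw [mem_closedBall_zero_iff]; linarith [norm_add_le (L.γ j s) w]
    have := hK.dist_le_mul _ h1 _ h2
    rw [dist_self_add_right, Real.dist_eq] at this
    linarith [le_abs_self (L.g j o (L.γ j s) - L.g j o (L.γ j s + w))]
  choose K hK0 hK using key
  refine ⟨∑ x, K x, Finset.sum_nonneg fun x _ => hK0 x, fun j o s hs w hw => ?_⟩
  have h1 : K ⟨j, o⟩ ≤ ∑ x, K x :=
    Finset.single_le_sum (fun x _ => hK0 x) (Finset.mem_univ (⟨j, o⟩ : Σ j, Fin (L.numObst j)))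
  have h2 := hK ⟨j, o⟩ s hs w hw
  have h3 := mul_le_mul_of_nonneg_right h1 (norm_nonneg w)
  simp only at h2
  linarith

theorem norm_extendField_le {φ : ℝ → E3} (hφ : ∀ r, ‖φ r‖ ≤ 1) {j : Fin N}
    {s : ℝ} : ‖L.extendField i a φ j s‖ ≤ 1 := by
  unfold extendField
  split_ifs
  · exact hφ _
  · exact hφ _
  · simp

/-- The first variation of length is a measure of finite mass. -/
theorem StronglyCritical.exists_bound (hL : L.StronglyCritical) :
    ∃ C, 0 ≤ C ∧ ∀ {i : Fin N} {a b : ℝ}, L.IsWindow i a b → ∀ φ : ℝ → E3, ContDiff ℝ ∞ φ →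
      SupportedIn φ a b → (∀ r, ‖φ r‖ ≤ 1) →
      -∫ s in a..b, inner ℝ (deriv (L.γ i) s) (deriv φ s) ≤ C := by
  obtain ⟨ε, hε, H⟩ := hL.exists_forall_neg_le
  obtain ⟨K, hK0, hK⟩ := L.exists_obstacle_lipschitz
  have hc : 0 ≤ K + 2 := by linarith
  -- Rate `2` covers a distance whose two points both move at speed at most `1`; rate `K` covers the
  -- obstacle functions.
  refine ⟨(K + 2) / ε, div_nonneg hc hε.le, fun {i a b} h φ hφ hsupp hφ1 => ?_⟩
  have hξ : ∀ j s, ‖L.extendField i a φ j s‖ ≤ 1 := fun j s => norm_extendField_le hφ1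
  refine H h hφ hsupp hc ?_ ?_
  · filter_upwards [self_mem_nhdsWithin] with t ht
    have ht0 : (0 : ℝ) < t := ht
    refine thickness_sub_le (mul_nonneg hc ht0.le) fun j k hjk s hs u hu => ?_
    have h1 := thickness_le hjk hs hu
    have h2 := dist_triangle4 (L.γ j s) (L.vary (L.extendField i a φ) t j s)
      (L.vary (L.extendField i a φ) t k u) (L.γ k u)
    have h3 : dist (L.γ j s) (L.vary (L.extendField i a φ) t j s) ≤ t := by
      rw [vary, dist_self_add_right, norm_smul, Real.norm_eq_abs, abs_of_pos ht0]
      exact mul_le_of_le_one_right ht0.le (hξ _ _)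
    have h4 : dist (L.vary (L.extendField i a φ) t k u) (L.γ k u) ≤ t := by
      rw [vary, dist_self_add_left, norm_smul, Real.norm_eq_abs, abs_of_pos ht0]
      exact mul_le_of_le_one_right ht0.le (hξ _ _)
    nlinarith
  · filter_upwards [self_mem_nhdsWithin, nhdsWithin_le_nhds (Iio_mem_nhds one_pos)] with t ht ht1
    have ht0 : (0 : ℝ) < t := ht
    refine obstacleMin_sub_le (mul_nonneg hc ht0.le) fun j o s hs => ?_
    have h1 := obstacleMin_le o hs
    have hn : ‖t • L.extendField i a φ j s‖ ≤ t := by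
      rw [norm_smul, Real.norm_eq_abs, abs_of_pos ht0]
      exact mul_le_of_le_one_right ht0.le (hξ _ _)
    have h2 := hK j o s hs _ (hn.trans (le_of_lt ht1))
    have h3 := mul_le_mul_of_nonneg_left hn hK0
    simp only [vary]
    linarith

/-- Near a corner, pushing the curve in the direction of the jump of the tangent does not decrease
the distance to another component to first order. -/
theorem eventually_thickness_le (h : L.IsWindow i a b) {x : ℝ} (hx : x ∈ Ioo a b) {p q : E3}
    (hp : HasDerivWithinAt (L.γ i) p (Iic x) x) (hq : HasDerivWithinAt (L.γ i) q (Ici x) x)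
    {η : ℝ} (hη : 0 < η) {j : Fin N} (hj : i ≠ j) :
    ∀ᶠ z : ℝ × ℝ in 𝓝 (x, 0), ∀ u ∈ Icc 0 (L.len j), ∀ c ∈ Icc (0 : ℝ) 1, z.1 ∈ Icc a b →
      0 ≤ z.2 → L.thickness L.γ - η * z.2 ≤
        dist (L.γ i z.1 + z.2 • c • (q - p)) (L.γ j u) := by
  set v := q - p with hv
  have hthi : ∀ s ∈ Icc a b, ∀ u ∈ Icc 0 (L.len j),
      L.thickness L.γ ≤ dist (L.γ i s) (L.γ j u) := by
    intro s hs u hu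
    obtain ⟨r, hr, hrs⟩ := h.exists_mem_Icc hs
    rw [hrs]
    exact thickness_le hj hr hu
  have hnhds : Icc a b ∈ 𝓝 x := Icc_mem_nhds hx.1 hx.2
  have hγx : ContinuousAt (L.γ i) x := h.lipschitzOnWith.continuousOn.continuousAt hnhds
  set y : Icc 0 (L.len j) → E3 := fun u => L.γ j u with hy
  have hyc : Continuous y := continuousOn_iff_continuous_domRestrict.1 (continuousOn_γ j)
  have key : ∀ u ∈ (univ : Set (Icc 0 (L.len j))), ∀ᶠ w : (ℝ × ℝ) × Icc 0 (L.len j) in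
      𝓝 ((x, (0 : ℝ)), u), ∀ c ∈ Icc (0 : ℝ) 1, w.1.1 ∈ Icc a b → 0 ≤ w.1.2 →
        L.thickness L.γ - η * w.1.2 ≤ dist (L.γ i w.1.1 + w.1.2 • c • v) (y w.2) := by
    intro u _
    have hX : ContinuousAt (fun w : (ℝ × ℝ) × Icc 0 (L.len j) => L.γ i w.1.1 - y w.2)
        ((x, 0), u) :=
      (ContinuousAt.comp (f := fun w : (ℝ × ℝ) × Icc 0 (L.len j) => w.1.1) hγx
        (by fun_prop)).sub (hyc.comp continuous_snd).continuousAt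
    rcases (hthi x (Ioo_subset_Icc_self hx) u u.2).lt_or_eq with hlt | heq
    -- The distance from `γ x` to `y u` exceeds the thickness: by continuity small displacements
    -- keep it so.
    · have hg : ContinuousAt (fun w : (ℝ × ℝ) × Icc 0 (L.len j) =>
          ‖L.γ i w.1.1 - y w.2‖ - |w.1.2| * ‖v‖) ((x, 0), u) := hX.norm.sub (by fun_prop)
      have hlt' : L.thickness L.γ < ‖L.γ i x - y u‖ - |(0 : ℝ)| * ‖v‖ := by
        rwa [abs_zero, zero_mul, sub_zero, ← dist_eq_norm]
      filter_upwards [hg.eventually (lt_mem_nhds hlt')] with w hw c hc _ ht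
      have h1 : ‖w.1.2 • c • v‖ ≤ |w.1.2| * ‖v‖ := by
        rw [norm_smul, Real.norm_eq_abs, norm_smul, Real.norm_eq_abs, abs_of_nonneg hc.1]
        gcongr
        exact mul_le_of_le_one_left (norm_nonneg _) hc.2
      have h2 : ‖L.γ i w.1.1 - y w.2‖ ≤
          ‖L.γ i w.1.1 + w.1.2 • c • v - y w.2‖ + ‖w.1.2 • c • v‖ := by
        have := norm_sub_le (L.γ i w.1.1 + w.1.2 • c • v - y w.2) (w.1.2 • c • v)
        rwa [add_sub_right_comm, add_sub_cancel_right, ← add_sub_right_comm] at this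
      rw [dist_eq_norm]
      nlinarith [mul_nonneg hη.le ht]
    -- The thickness is attained here, so `x` minimizes the distance to `y u` along the curve and
    -- the push has nonnegative inner product with `γ x - y u`. Disjointness makes that vector
    -- nonzero, so the slack `η * ‖X‖` renders the inequality strict, hence stable nearby.
    · have hmin : ∀ᶠ s in 𝓝 x, ‖L.γ i x - y u‖ ^ 2 ≤ ‖L.γ i s - y u‖ ^ 2 := by
        filter_upwards [hnhds] with s hs
        rw [← dist_eq_norm, ← dist_eq_norm]
        exact pow_le_pow_left₀ dist_nonneg (heq ▸ hthi s hs u u.2) 2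
      have hG : HasFDerivAt (fun z : E3 => ‖z - y u‖ ^ 2)
          (2 • (innerSL ℝ (L.γ i x - y u)).comp (ContinuousLinearMap.id ℝ E3)) (L.γ i x) :=
        ((hasFDerivAt_id _).sub_const (y u)).norm_sq
      have h0 := fderiv_sub_nonneg_of_min hG hp hq hmin
      have h0' : 0 ≤ inner ℝ (L.γ i x - y u) v := by
        rw [inner_sub_left, sub_nonneg]
        simpa using h0
      have hne : L.γ i x - y u ≠ 0 := by
        obtain ⟨r, hr, hrs⟩ := h.exists_mem_Icc (Ioo_subset_Icc_self hx)
        rw [hrs]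
        exact sub_ne_zero.2 (L.disjoint i j hj r hr u u.2)
      have hg : ContinuousAt (fun w : (ℝ × ℝ) × Icc 0 (L.len j) =>
          inner ℝ (L.γ i w.1.1 - y w.2) v + η * ‖L.γ i w.1.1 - y w.2‖) ((x, 0), u) :=
        (hX.inner continuousAt_const).add (hX.norm.const_mul η)
      have hpos : 0 < inner ℝ (L.γ i x - y u) v + η * ‖L.γ i x - y u‖ :=
        add_pos_of_nonneg_of_pos h0' (mul_pos hη (norm_pos_iff.2 hne))
      filter_upwards [hg.eventually (lt_mem_nhds hpos)] with w hw c hc hs ht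
      have hd := hthi _ hs w.2 w.2.2
      rw [dist_eq_norm] at hd ⊢
      change L.thickness L.γ ≤ ‖L.γ i w.1.1 - y w.2‖ at hd
      rw [add_sub_right_comm]
      set X := L.γ i w.1.1 - y w.2 with hXdef
      have hXpos : 0 < ‖X‖ := by
        rw [norm_pos_iff]
        rintro h0
        rw [h0] at hw
        simp at hw
      -- Cauchy–Schwarz against `X` bounds the new distance below by `‖X‖ - w.1.2 * c * η`.
      have h1 := real_inner_le_norm X (X + w.1.2 • c • v)
      rw [inner_add_right, real_inner_self_eq_norm_sq, inner_smul_right, inner_smul_right] at h1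
      have htc : 0 ≤ w.1.2 * c := mul_nonneg ht hc.1
      have h2 : ‖X‖ * (‖X‖ - w.1.2 * c * η) ≤ ‖X‖ * ‖X + w.1.2 • c • v‖ := by
        nlinarith [mul_le_mul_of_nonneg_left hw.le htc]
      have h3 := le_of_mul_le_mul_left h2 hXpos
      have h4 : w.1.2 * c * η ≤ η * w.1.2 := by
        nlinarith [mul_nonneg (mul_nonneg hη.le ht) (sub_nonneg.2 hc.2)]
      linarith
  -- Compactness of the component `j` gives one neighbourhood of `(x, 0)` for all `u`.
  have := isCompact_univ.eventually_forall_of_forall_eventually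
    (P := fun (z : ℝ × ℝ) (u : Icc 0 (L.len j)) => ∀ c ∈ Icc (0 : ℝ) 1, z.1 ∈ Icc a b → 0 ≤ z.2 →
      L.thickness L.γ - η * z.2 ≤ dist (L.γ i z.1 + z.2 • c • v) (y u)) key
  filter_upwards [this] with z hz u hu c hc hs ht
  exact hz ⟨u, hu⟩ (mem_univ _) c hc hs ht

/-- Near a corner, pushing the curve in the direction of the jump of the tangent does not decrease
the obstacle functions to first order. -/
theorem eventually_obstacleMin_le (h : L.IsWindow i a b) {x : ℝ} (hx : x ∈ Ioo a b) {p q : E3}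
    (hp : HasDerivWithinAt (L.γ i) p (Iic x) x) (hq : HasDerivWithinAt (L.γ i) q (Ici x) x)
    {η : ℝ} (hη : 0 < η) (o : Fin (L.numObst i)) :
    ∀ᶠ z : ℝ × ℝ in 𝓝 (x, 0), ∀ c ∈ Icc (0 : ℝ) 1, z.1 ∈ Icc a b →
      0 ≤ z.2 → L.obstacleMin L.γ - η * z.2 ≤ L.g i o (L.γ i z.1 + z.2 • c • (q - p)) := by
  set v := q - p with hv
  set G := L.g i o with hG
  have hobs : ∀ s ∈ Icc a b, L.obstacleMin L.γ ≤ G (L.γ i s) := by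
    intro s hs
    obtain ⟨r, hr, hrs⟩ := h.exists_mem_Icc hs
    rw [hrs]
    exact obstacleMin_le o hr
  have hnhds : Icc a b ∈ 𝓝 x := Icc_mem_nhds hx.1 hx.2
  have hγx : ContinuousAt (L.γ i) x := h.lipschitzOnWith.continuousOn.continuousAt hnhds
  have hGd : Differentiable ℝ G := (L.g_contDiff i o).differentiable (by simp)
  have hpt : ∀ c : ℝ, ContinuousAt
      (fun w : (ℝ × ℝ) × ℝ => L.γ i w.1.1 + w.1.2 • w.2 • v) ((x, 0), c) := fun c =>
    (ContinuousAt.comp (f := fun w : (ℝ × ℝ) × ℝ => w.1.1) hγx (by fun_prop)).add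
      (by fun_prop)
  have hpt0 : ∀ c : ℝ, L.γ i x + (0 : ℝ) • c • v = L.γ i x := fun c => by simp
  have tube : ∀ U : Set E3, U ∈ 𝓝 (L.γ i x) → ∀ᶠ z : ℝ × ℝ in 𝓝 (x, 0), ∀ c ∈ Icc (0 : ℝ) 1,
      L.γ i z.1 + z.2 • c • v ∈ U := by
    intro U hU
    refine isCompact_Icc.eventually_forall_of_forall_eventually
      (P := fun (z : ℝ × ℝ) (c : ℝ) => L.γ i z.1 + z.2 • c • v ∈ U) fun c _ => ?_
    exact (hpt c).preimage_mem_nhds (by simpa [hpt0] using hU)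
  rcases (hobs x (Ioo_subset_Icc_self hx)).lt_or_eq with hlt | heq
  · have hU : G ⁻¹' Ioi (L.obstacleMin L.γ) ∈ 𝓝 (L.γ i x) :=
      hGd.continuous.continuousAt.preimage_mem_nhds (Ioi_mem_nhds hlt)
    filter_upwards [tube _ hU] with z hz c hc _ ht
    have : L.obstacleMin L.γ < G (L.γ i z.1 + z.2 • c • v) := hz c hc
    nlinarith [mul_nonneg hη.le ht]
  · have hmin : ∀ᶠ s in 𝓝 x, G (L.γ i x) ≤ G (L.γ i s) := by
      filter_upwards [hnhds] with s hs
      rw [← heq]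
      exact hobs s hs
    have h0 : 0 ≤ fderiv ℝ G (L.γ i x) v :=
      fderiv_sub_nonneg_of_min (hGd _).hasFDerivAt hp hq hmin
    have hfc : Continuous fun z => fderiv ℝ G z v :=
      ((L.g_contDiff i o).continuous_fderiv (by simp)).clm_apply continuous_const
    have hU : {z | -η < fderiv ℝ G z v} ∈ 𝓝 (L.γ i x) :=
      hfc.continuousAt.eventually (lt_mem_nhds (by linarith))
    filter_upwards [tube _ hU] with z hz c hc hs ht
    have hd : ∀ r : ℝ, HasDerivAt (fun r : ℝ => G (L.γ i z.1 + z.2 • r • v))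
        (z.2 * fderiv ℝ G (L.γ i z.1 + z.2 • r • v) v) r := by
      intro r
      have h1 : HasDerivAt (fun r : ℝ => L.γ i z.1 + z.2 • r • v) (z.2 • v) r := by
        simpa using (((hasDerivAt_id r).smul_const v).fun_const_smul z.2).const_add (L.γ i z.1)
      have := (hGd _).hasFDerivAt.comp_hasDerivAt r h1
      rwa [map_smul, smul_eq_mul] at this
    -- Mean value inequality along the push: `tube` keeps the whole segment where the derivative of
    -- `G` along `v` exceeds `-η`.
    have hmv := (convex_Icc (0 : ℝ) 1).mul_sub_le_image_sub_of_le_deriv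
      (f := fun r : ℝ => G (L.γ i z.1 + z.2 • r • v)) (C := z.2 * -η)
      (fun r _ => (hd r).continuousAt.continuousWithinAt)
      (fun r _ => (hd r).differentiableAt.differentiableWithinAt)
      (fun r hr => by
        rw [(hd r).deriv]
        exact mul_le_mul_of_nonneg_left (le_of_lt (hz r (interior_subset hr))) ht)
      0 ⟨le_rfl, zero_le_one⟩ c hc hc.1
    simp only [zero_smul, smul_zero, add_zero, sub_zero] at hmv
    have h3 := hobs _ hs
    have h4 : z.2 * η * c ≤ η * z.2 := by
      nlinarith [mul_nonneg (mul_nonneg hη.le ht) (sub_nonneg.2 hc.2)]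
    linarith

/-- Cutting off a corner decreases length to first order by at most an arbitrarily small amount. -/
theorem StronglyCritical.exists_cutoff_bound (hL : L.StronglyCritical) (h : L.IsWindow i a b)
    {x : ℝ} (hx : x ∈ Ioo a b) {p q : E3} (hp : HasDerivWithinAt (L.γ i) p (Iic x) x)
    (hq : HasDerivWithinAt (L.γ i) q (Ici x) x) {η : ℝ} (hη : 0 < η) :
    ∃ δ > 0, ∀ χ : ℝ → ℝ, ContDiff ℝ ∞ χ → SupportedIn χ (x - δ) (x + δ) →
      (∀ r, χ r ∈ Icc (0 : ℝ) 1) →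
      -∫ s in a..b, inner ℝ (deriv (L.γ i) s) (deriv (fun r => χ r • (q - p)) s) ≤ η := by
  obtain ⟨ε, hε, H⟩ := hL.exists_forall_neg_le
  have hηε : 0 < η * ε := mul_pos hη hε
  have hthi : ∀ᶠ z : ℝ × ℝ in 𝓝 (x, 0), ∀ j, i ≠ j → ∀ u ∈ Icc 0 (L.len j),
      ∀ c ∈ Icc (0 : ℝ) 1, z.1 ∈ Icc a b → 0 ≤ z.2 → L.thickness L.γ - η * ε * z.2 ≤
        dist (L.γ i z.1 + z.2 • c • (q - p)) (L.γ j u) := by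
    rw [eventually_all]
    intro j
    by_cases hj : i = j
    · exact Eventually.of_forall fun z hne => absurd hj hne
    · filter_upwards [eventually_thickness_le h hx hp hq hηε hj] with z hz _ using hz
  have hobs : ∀ᶠ z : ℝ × ℝ in 𝓝 (x, 0), ∀ o : Fin (L.numObst i), ∀ c ∈ Icc (0 : ℝ) 1,
      z.1 ∈ Icc a b → 0 ≤ z.2 → L.obstacleMin L.γ - η * ε * z.2 ≤
        L.g i o (L.γ i z.1 + z.2 • c • (q - p)) :=
    eventually_all.2 fun o => eventually_obstacleMin_le h hx hp hq hηε o
  obtain ⟨δ₀, hδ₀, hball⟩ := Metric.eventually_nhds_iff.1 (hthi.and hobs)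
  set δ := min δ₀ (min (x - a) (b - x)) with hδdef
  have hδ : 0 < δ := lt_min hδ₀ (lt_min (sub_pos.2 hx.1) (sub_pos.2 hx.2))
  have hδa : δ ≤ x - a := (min_le_right _ _).trans (min_le_left _ _)
  have hδb : δ ≤ b - x := (min_le_right _ _).trans (min_le_right _ _)
  refine ⟨δ, hδ, fun χ hχ hsupp hχ1 => ?_⟩
  have hφ : ContDiff ℝ ∞ fun r => χ r • (q - p) := hχ.smul contDiff_const
  have hsuppφ : SupportedIn (fun r => χ r • (q - p)) a b := by
    obtain ⟨c, d, hc, hd, h0⟩ := hsupp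
    exact ⟨c, d, by linarith, by linarith, fun r hr => by simp only; rw [h0 r hr, zero_smul]⟩
  have hχ0 : ∀ r, δ₀ ≤ |r - x| → χ r = 0 := by
    obtain ⟨c, d, hc, hd, h0⟩ := hsupp
    intro r hr
    refine h0 r fun hm => ?_
    have : |r - x| < δ := abs_lt.2 ⟨by linarith [hm.1], by linarith [hm.2]⟩
    exact absurd (this.trans_le (min_le_left _ _)) (not_lt.2 hr)
  have hnear : ∀ r t : ℝ, |r - x| < δ₀ → 0 < t → t < δ₀ → dist (r, t) (x, (0 : ℝ)) < δ₀ := by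
    intro r t hr ht ht'
    rw [Prod.dist_eq, max_lt_iff, Real.dist_eq, Real.dist_eq, sub_zero, abs_of_pos ht]
    exact ⟨hr, ht'⟩
  have hsmall : ∀ᶠ t in 𝓝[>] (0 : ℝ), 0 < t ∧ t < δ₀ := by
    filter_upwards [self_mem_nhdsWithin, nhdsWithin_le_nhds (Iio_mem_nhds hδ₀)] with t ht ht'
      using ⟨ht, ht'⟩
  -- The rate `η * ε` cancels the `ε` of the first variation inequality.
  have hres := H h hφ hsuppφ hηε.le (c := η * ε) ?_ ?_
  · rwa [mul_div_assoc, div_self hε.ne', mul_one] at hres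
  · filter_upwards [hsmall] with t ht
    have hct : 0 ≤ η * ε * t := mul_nonneg hηε.le ht.1.le
    have main : ∀ k, i ≠ k → ∀ s ∈ Icc 0 (L.len i), ∀ u ∈ Icc 0 (L.len k),
        L.thickness L.γ - η * ε * t ≤
          dist (L.vary (L.extendField i a fun r => χ r • (q - p)) t i s)
            (L.vary (L.extendField i a fun r => χ r • (q - p)) t k u) := by
      intro k hk s hs u hu
      have hk0 : L.vary (L.extendField i a fun r => χ r • (q - p)) t k u = L.γ k u := by
        rw [vary, extendField_of_ne hk.symm]; simp
      obtain ⟨r, hr, hγ, hξ⟩ := exists_mem_window (fun r => χ r • (q - p)) h hs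
      rw [hk0, vary, hξ]
      rcases lt_or_ge |r - x| δ₀ with hlt | hge
      · rw [hγ]
        exact (hball (hnear r t hlt ht.1 ht.2)).1 k hk u hu (χ r) (hχ1 r) hr ht.1.le
      · rw [hχ0 r hge, zero_smul, smul_zero, add_zero]
        linarith [thickness_le hk hs hu]
    refine thickness_sub_le hct fun j k hjk s hs u hu => ?_
    by_cases hj : i = j
    · subst hj
      exact main k hjk s hs u hu
    by_cases hk : i = k
    · subst hk
      rw [dist_comm]
      exact main j hjk.symm u hu s hs
    rw [vary, vary, extendField_of_ne (Ne.symm hj), extendField_of_ne (Ne.symm hk)]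
    simp only [Pi.zero_apply, smul_zero, add_zero]
    linarith [thickness_le hjk hs hu]
  · filter_upwards [hsmall] with t ht
    have hct : 0 ≤ η * ε * t := mul_nonneg hηε.le ht.1.le
    refine obstacleMin_sub_le hct fun j o s hs => ?_
    by_cases hj : i = j
    · subst hj
      obtain ⟨r, hr, hγ, hξ⟩ := exists_mem_window (fun r => χ r • (q - p)) h hs
      rw [vary, hξ]
      rcases lt_or_ge |r - x| δ₀ with hlt | hge
      · rw [hγ]
        exact (hball (hnear r t hlt ht.1 ht.2)).2 o (χ r) (hχ1 r) hr ht.1.le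
      · rw [hχ0 r hge, zero_smul, smul_zero, add_zero]
        linarith [obstacleMin_le o hs]
    · rw [vary, extendField_of_ne (Ne.symm hj)]
      simp only [Pi.zero_apply, smul_zero, add_zero]
      linarith [obstacleMin_le o hs]

/-- The parameters of a window at which the tangent is a unit vector and the limit of its
mollifications. -/
def tangentPoints (L : GeneralizedLink N) (i : Fin N) (a b : ℝ) : Set ℝ :=
  {x ∈ regularPoints (deriv (L.γ i)) a b | DifferentiableAt ℝ (L.γ i) x ∧ ‖deriv (L.γ i) x‖ = 1}

theorem IsWindow.ae_mem_tangentPoints (h : L.IsWindow i a b) :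
    ∀ᵐ x : ℝ, x ∈ Ioo a b → x ∈ L.tangentPoints i a b := by
  filter_upwards [ae_mem_regularPoints h.lt.le (h.lipschitzOnWith.intervalIntegrable_deriv' h.lt.le),
    h.lipschitzOnWith.ae_differentiableAt_Ioo,
    ae_norm_deriv_eq_one h.lt.le h.lipschitzOnWith h.length_eq] with x h1 h2 h3 hx
  exact ⟨h1 hx, h2 hx, h3 hx⟩

/-- The mass bound supplies bounded variation of the tangent, and the cutoff bound excludes jumps.
-/
theorem StronglyCritical.contDiffOn_window (hL : L.StronglyCritical) (h : L.IsWindow i a b) :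
    ContDiffOn ℝ 1 (L.γ i) (Icc a b) := by
  obtain ⟨C, -, hC⟩ := hL.exists_bound
  have hint := h.lipschitzOnWith.intervalIntegrable_deriv' h.lt.le
  have hBV := (eVariationOn.mono (deriv (L.γ i))
    (show L.tangentPoints i a b ⊆ _ from sep_subset _ _)).trans
    (eVariationOn_regularPoints_le hint (hC h))
  refine contDiffOn_one_of_boundedVariationOn_deriv h.lt h.lipschitzOnWith
    (S := L.tangentPoints i a b) (fun x hx => hx.1.1) h.ae_mem_tangentPoints (fun x hx => hx.2.1)
    (hBV.trans_lt ENNReal.ofReal_lt_top).ne ?_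
  intro x hx p q hp hq η hη
  obtain ⟨δ, hδ, hcut⟩ := hL.exists_cutoff_bound h hx hp hq hη
  refine ⟨δ, hδ, fun y hy z hz h1 h2 h3 h4 => ?_⟩
  exact inner_sub_le_of_forall_cutoff hint hcut hy.1 hz.1 h1 (h2.trans h3).le h4

theorem StronglyCritical.exists_sum_angle_le (hL : L.StronglyCritical) :
    ∃ C : ℝ, ∀ {i : Fin N} {a b : ℝ}, L.IsWindow i a b → ∀ {k : ℕ} {t : ℕ → ℝ},
      (∀ m ≤ k, t m < t (m + 1)) → a ≤ t 0 → t (k + 1) ≤ b →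
      ∑ m ∈ Finset.range k, InnerProductGeometry.angle (L.γ i (t (m + 1)) - L.γ i (t m))
        (L.γ i (t (m + 2)) - L.γ i (t (m + 1))) ≤ C := by
  obtain ⟨C, hC0, hC⟩ := hL.exists_bound
  refine ⟨3 * Real.pi * C, fun {i a b} h {k t} ht h0 hk => ?_⟩
  have hint := h.lipschitzOnWith.intervalIntegrable_deriv' h.lt.le
  have hBV := (eVariationOn.mono (deriv (L.γ i))
    (show L.tangentPoints i a b ⊆ _ from sep_subset _ _)).trans
    (eVariationOn_regularPoints_le hint (hC h))
  exact sum_angle_le_of_eVariationOn_deriv_le h.lipschitzOnWith h.ae_mem_tangentPoints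
    (fun x hx => hx.2.2) hC0 hBV ht h0 hk

theorem StronglyCritical.isC1 (hL : L.StronglyCritical) : L.IsC1 := by
  intro i
  by_cases hc : L.closed i
  · intro x _
    have hl := L.len_pos i
    -- Centring the window at `x` makes `x` an interior point, so no seam has to be glued.
    have h : L.IsWindow i (x - L.len i / 2) (x + L.len i / 2) :=
      ⟨by ring, fun hn => absurd hc hn⟩
    exact ((hL.contDiffOn_window h).contDiffAt
      (Icc_mem_nhds (by linarith) (by linarith))).contDiffWithinAt
  · refine (hL.contDiffOn_window (isWindow_zero i)).mono fun s hs => hs hc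

theorem StronglyCritical.isFTC (hL : L.StronglyCritical) : L.IsFTC := by
  obtain ⟨C, hC⟩ := hL.exists_sum_angle_le
  refine ENNReal.sum_lt_top.2 fun i _ => ?_
  -- A closed polygon is cut open at its vertex `t 0`; the turning angle lost there is at most `π`.
  refine lt_of_le_of_lt (b := ENNReal.ofReal (C + Real.pi)) ?_ ENNReal.ofReal_lt_top
  refine iSup_le fun k => iSup_le fun t => iSup_le fun ht => ENNReal.ofReal_le_ofReal ?_
  obtain ⟨hlt, hper, harc⟩ := ht
  have hpi := Real.pi_pos
  by_cases hc : L.closed i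
  · have h : L.IsWindow i (t 0) (t 0 + L.len i) := ⟨by ring, fun hn => absurd hc hn⟩
    cases k with
    | zero =>
      -- A polygon with no turning angles, used only to obtain `0 ≤ C`.
      have := hC h (k := 0) (t := fun m => t 0 + m * L.len i)
        (fun m _ => by push_cast; linarith [L.len_pos i]) (by simp) (by simp)
      simp only [Finset.range_zero, Finset.sum_empty] at this ⊢
      linarith
    | succ k =>
      rw [Finset.sum_range_succ]
      refine add_le_add ?_ (InnerProductGeometry.angle_le_pi _ _)
      refine hC h (fun m hm => (hlt m (by lia)).1) le_rfl (le_of_eq ?_)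
      have := hper hc 0
      rwa [zero_add] at this
  · have := hC (isWindow_zero i) (fun m hm => (hlt m hm).1) (harc hc 0 (by lia)).1
      (harc hc (k + 1) le_rfl).2
    linarith

end GeneralizedLink

theorem mainTheorem8 {N : ℕ} (L : GeneralizedLink N) (hL : L.StronglyCritical) :
    L.IsFTC ∧ L.IsC1 :=
  ⟨hL.isFTC, hL.isC1⟩
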